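/- All algebras are associative. Let $G$ be an abelian group, written additively, and let $\mathcal D$ be a real algebra isomorphic to $M_n(\mathbb R)$ (respectively $M_n(\mathbb H)$) with $n\ge 1$. A $G$-grading on $\mathcal D$ is a decomposition $\mathcal D=\bigoplus_{g\in G}\mathcal D_g$ into subspaces with $\mathcal D_g\mathcal D_h\subseteq \mathcal D_{g+h}$; its support is $\{g\in G:\mathcal D_g\ne 0\}$; it is a division grading if every nonzero homogeneous element is invertible. Two $G$-gradings on $\mathcal D$ are isomorphic if some algebra automorphism $\varphi$ of $\mathcal D$ satisfies $\varphi(\mathcal D_g)=\mathcal D'_g$ for all $g\in G$. A $G$-grading on $\mathcal D$ and an $H$-grading on $\mathcal D'$ are equivalent if there are an algebra isomorphism $\varphi:\mathcal D\to\mathcal D'$ and a bijection $\alpha$ of their supports such that $\varphi(\mathcal D_t)=\mathcal D'_{\alpha(t)}$ for all $t$ in the support. For a finite-dimensional vector space $T$ over $\mathbb F_2$, a quadratic form $\mu:T\to\mathbb F_2$ has type I if its polar form $\beta(u,v)=\mu(u+v)-\mu(u)-\mu(v)$ has zero radical. Its Arf invariant is $\sum_i\mu(a_i)\mu(b_i)\in\mathbb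 F_2$, where $a_1,b_1,\dots,a_k,b_k$ is a symplectic basis of $T$, that is, a basis with $\beta(a_i,b_j)=\delta_{ij}$ and $\beta(a_i,a_j)=\beta(b_i,b_j)=0$. (In multiplicative notation the values $0,1\in\mathbb F_2$ are written $+1,-1$.) **Theorem.** 1. If there is a division $G$-grading on $\mathcal D$ whose nonzero homogeneous components all have dimension $1$, then $n=2^m$ for some integer $m\ge 0$, and the support of the grading is a subgroup $T$ of $G$ isomorphic to $\mathbb Z_2^{2m}$ (respectively $\mathbb Z_2^{2m+2}$). 2. Let $n=2^m$. The isomorphism classes of such $G$-gradings on $\mathcal D$ are in one-to-one correspondence with the pairs $(T,\mu)$ formed by a subgroup $T$ of $G$ isomorphic to $\mathbb Z_2^{2m}$ (respectively $\mathbb Z_2^{2m+2}$) and a quadratic form $\mu:T\to\mathbb F_2$ of type I with Arf invariant $0$, i.e. $+1$ in multiplicative notation (respectively $1$, i.e. $-1$). The correspondence sends a grading to the pair $(T,\mu)$ where $T$ is its support and, for every $t\in T$, some $X_t\in\mathcal D_t$ satisfies $X_t^2=(-1)^{\mu(t)}1$. 3. Let $n=2^m$. All such gradings (for all abelian groups $G$)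 belong to one equivalence class. It is represented by the tensor product $M_2(\mathbb R)^{\otimes m}$, which for $m=0$ is $\mathbb R$ with the trivial grading (respectively $M_2(\mathbb R)^{\otimes m}\otimes\mathbb H$), with the product grading. Here the product grading on $\mathcal A\otimes\mathcal B$ has components $(\mathcal A\otimes\mathcal B)_{(g,h)}=\mathcal A_g\otimes\mathcal B_h$; $\mathbb H=\mathbb R1\oplus\mathbb Ri\oplus\mathbb Rj\oplus\mathbb Rk$ is graded by $\mathbb Z_2^2$; and $$M_2(\mathbb R)=\mathbb R\begin{pmatrix}1&0\\0&1\end{pmatrix}\oplus\mathbb R\begin{pmatrix}0&1\\1&0\end{pmatrix}\oplus\mathbb R\begin{pmatrix}-1&0\\0&1\end{pmatrix}\oplus\mathbb R\begin{pmatrix}0&-1\\1&0\end{pmatrix}$$ is graded by $\mathbb Z_2^2$, the summands in both cases having degrees $(0,0),(1,0),(0,1),(1,1)$. This tensor product is isomorphic to $M_{2^m}(\mathbb R)$ (respectively $M_{2^m}(\mathbb H)$), and its product grading is a division grading with components of dimension $1$. 4. The Arf invariant is well defined: for every quadratic form of type I on a finite vector space over $\mathbb F_2$ a symplectic basis exists,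 and $\sum_i\mu(a_i)\mu(b_i)$ takes the same value in all symplectic bases. -/

import Mathlib

open scoped TensorProduct Quaternion

namespace RealDivGrading

section Gradings

variable {G H : Type*} [AddCommGroup G] [AddCommGroup H]
variable {A B : Type*} [Ring A] [Algebra ℝ A] [Ring B] [Algebra ℝ B]

open scoped Classical in
/-- A grading of the real algebra `A` by the abelian group `G` (written additively): `A` is the
direct sum of the subspaces `𝒜 g`, and `𝒜 g * 𝒜 h ⊆ 𝒜 (g + h)`. -/
structure IsGrading (𝒜 : G → Submodule ℝ A) : Prop where
  isInternal : DirectSum.IsInternal 𝒜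
  mul_mem : ∀ ⦃g h : G⦄ ⦃x y : A⦄, x ∈ 𝒜 g → y ∈ 𝒜 h → x * y ∈ 𝒜 (g + h)

/-- The support of a grading. -/
def support (𝒜 : G → Submodule ℝ A) : Set G := {g | 𝒜 g ≠ ⊥}

/-- A division grading (every nonzero homogeneous element is invertible) all of whose nonzero
homogeneous components have dimension one. -/
structure IsDivGradingDimOne (𝒜 : G → Submodule ℝ A) : Prop extends IsGrading 𝒜 where
  isUnit : ∀ (g : G), ∀ x ∈ 𝒜 g, x ≠ 0 → IsUnit x
  finrank_eq_one : ∀ g ∈ support 𝒜, Module.finrank ℝ (𝒜 g) = 1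

/-- Equivalence of gradings, possibly by different groups: an isomorphism of algebras
that carries homogeneous components to homogeneous components, according to a bijection of the
supports. -/
def Equivalent (𝒜 : G → Submodule ℝ A) (ℬ : H → Submodule ℝ B) : Prop :=
  ∃ (φ : A ≃ₐ[ℝ] B) (α : support 𝒜 ≃ support ℬ),
    ∀ t : support 𝒜, (𝒜 t).map φ.toLinearMap = ℬ (α t)

/-- Isomorphism of gradings by the same group: an isomorphism of algebras that preserves the
homogeneous components of each degree. -/
def Isomorphic (𝒜 : G → Submodule ℝ A) (ℬ : G → Submodule ℝ B) : Prop :=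
  ∃ φ : A ≃ₐ[ℝ] B, ∀ g : G, (𝒜 g).map φ.toLinearMap = ℬ g

variable (G A) in
/-- The division `G`-gradings on `A` with components of dimension one. -/
abbrev DivGradingDimOne : Type _ := {𝒜 : G → Submodule ℝ A // IsDivGradingDimOne 𝒜}

variable (G A) in
/-- Isomorphism, as an equivalence relation. -/
def isoSetoid : Setoid (DivGradingDimOne G A) where
  r 𝒜 ℬ := Isomorphic 𝒜.1 ℬ.1
  iseqv :=
    { refl := fun 𝒜 => ⟨AlgEquiv.refl, fun _ => Submodule.map_id _⟩
      symm := by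
        rintro 𝒜 ℬ ⟨φ, h⟩
        refine ⟨φ.symm, fun g => ?_⟩
        ext x
        simp [← h g]
      trans := by
        rintro 𝒜 ℬ 𝒞 ⟨φ, h⟩ ⟨ψ, k⟩
        refine ⟨φ.trans ψ, fun g => ?_⟩
        rw [← k g, ← h g, ← Submodule.map_comp]
        rfl }

variable (G A) in
/-- The isomorphism classes of division `G`-gradings on `A` with components of dimension one. -/
abbrev IsoClasses : Type _ := Quotient (isoSetoid G A)

/-- The product grading on `A ⊗ B`, by the group `G × H`: its component of degree `(g, h)` is
`𝒜 g ⊗ ℬ h`. -/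
noncomputable def productGrading (𝒜 : G → Submodule ℝ A) (ℬ : H → Submodule ℝ B) :
    G × H → Submodule ℝ (A ⊗[ℝ] B) :=
  fun p => LinearMap.range (TensorProduct.mapIncl (𝒜 p.1) (ℬ p.2))

end Gradings

section Representatives

/-- The family of subspaces `ℝ 1`, `ℝ x`, `ℝ y`, `ℝ z`, placed in the degrees `(0, 0)`, `(1, 0)`,
`(0, 1)`, `(1, 1)` of `ℤ₂²`. -/
def fourLines {A : Type*} [Ring A] [Algebra ℝ A] (x y z : A) : ZMod 2 × ZMod 2 → Submodule ℝ A :=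
  fun g => Submodule.span ℝ
    {if g = (0, 0) then 1 else if g = (1, 0) then x else if g = (0, 1) then y else z}

/-- A real algebra with a family of subspaces indexed by an abelian group. It only serves to
write down iterated tensor products of graded algebras by recursion. -/
structure Graded where
  grp : Type
  [grpInst : AddCommGroup grp]
  alg : Type
  [ringInst : Ring alg]
  [algInst : Algebra ℝ alg]
  comp : grp → Submodule ℝ alg

attribute [instance] Graded.grpInst Graded.ringInst Graded.algInst

/-- The tensor product, with the product grading. -/
noncomputable def Graded.tensor (X Y : Graded) : Graded where
  grp := X.grp × Y.grp
  alg := X.alg ⊗[ℝ] Y.alg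
  comp := productGrading X.comp Y.comp

/-- `ℝ` with the trivial grading (by the trivial group). -/
noncomputable def gradedR : Graded where
  grp := Unit
  alg := ℝ
  comp := fun _ => ⊤

/-- `M₂(ℝ)` graded by `ℤ₂²`. -/
noncomputable def gradedM2R : Graded where
  grp := ZMod 2 × ZMod 2
  alg := Matrix (Fin 2) (Fin 2) ℝ
  comp := fourLines !![0, 1; 1, 0] !![-1, 0; 0, 1] !![0, -1; 1, 0]

/-- `ℍ` graded by `ℤ₂²`, with components spanned by `1`, `i`, `j` and `k`. -/
noncomputable def gradedH : Graded where
  grp := ZMod 2 × ZMod 2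
  alg := ℍ[ℝ]
  comp := fourLines (A := ℍ[ℝ]) ⟨0, 1, 0, 0⟩ ⟨0, 0, 1, 0⟩ ⟨0, 0, 0, 1⟩

/-- `M₂(ℝ) ⊗ (M₂(ℝ) ⊗ ⋯ ⊗ (M₂(ℝ) ⊗ X))`, with `m` factors `M₂(ℝ)` graded by `ℤ₂²`, and with the
product grading, by the group `ℤ₂² × (ℤ₂² × ⋯ × (ℤ₂² × X.grp))`. -/
noncomputable def tensorM2R (X : Graded) : ℕ → Graded
  | 0 => X
  | m + 1 => gradedM2R.tensor (tensorM2R X m)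

end Representatives

section QuadraticForms

variable {V : Type*} [AddCommGroup V] [Module (ZMod 2) V]

/-- A quadratic form over `𝔽₂` has type I if the radical of its polar form is zero. -/
def IsTypeI (Q : QuadraticForm (ZMod 2) V) : Prop :=
  ∀ v : V, (∀ u : V, QuadraticMap.polar Q u v = 0) → v = 0

/-- A basis `a₁, …, aₘ, b₁, …, bₘ` (with `aᵢ = B (inl i)` and `bᵢ = B (inr i)`) that is symplectic
for the polar form of `Q` (which is symmetric). -/
structure IsSymplectic (Q : QuadraticForm (ZMod 2) V) {m : ℕ}
    (B : Module.Basis (Fin m ⊕ Fin m) (ZMod 2) V) : Prop where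
  inl_inl : ∀ i j, QuadraticMap.polar Q (B (.inl i)) (B (.inl j)) = 0
  inr_inr : ∀ i j, QuadraticMap.polar Q (B (.inr i)) (B (.inr j)) = 0
  inl_inr : ∀ i j, QuadraticMap.polar Q (B (.inl i)) (B (.inr j)) = if i = j then 1 else 0

/-- `ε` is the Arf invariant of `Q`, computed in some symplectic basis. The values `0` and `1` of
`𝔽₂` are the additive version of the values `+1` and `-1`. -/
def HasArf (Q : QuadraticForm (ZMod 2) V) (ε : ZMod 2) : Prop :=
  ∃ (m : ℕ) (B : Module.Basis (Fin m ⊕ Fin m) (ZMod 2) V),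
    IsSymplectic Q B ∧ ∑ i, Q (B (.inl i)) * Q (B (.inr i)) = ε

end QuadraticForms

/-- The pairs `(T, μ)` formed by a subgroup `T` of `G` isomorphic to `ℤ₂ʳ` and a quadratic form `μ`
on `T` over `𝔽₂` of type I and Arf invariant `ε`. (An abelian group has at most one structure
of vector space over `𝔽₂`.) -/
@[ext]
structure QuadPair (G : Type*) [AddCommGroup G] (r : ℕ) (ε : ZMod 2) where
  T : AddSubgroup G
  μ : T → ZMod 2
  iso : Nonempty (T ≃+ (Fin r → ZMod 2))
  isQuad : ∃ (_ : Module (ZMod 2) T) (Q : QuadraticForm (ZMod 2) T),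
    (∀ t, Q t = μ t) ∧ IsTypeI Q ∧ HasArf Q ε

/-- The pair `(T, μ)` is read off from the grading: `T` is the support, and each component of degree
`t ∈ T` contains an element whose square is `(-1) ^ μ(t)`. -/
def QuadPair.IsAttachedTo {G : Type*} [AddCommGroup G] {A : Type*} [Ring A] [Algebra ℝ A]
    {r : ℕ} {ε : ZMod 2} (p : QuadPair G r ε) (𝒜 : G → Submodule ℝ A) : Prop :=
  (p.T : Set G) = support 𝒜 ∧ ∀ t : p.T, ∃ x ∈ 𝒜 t, x * x = (-1) ^ (p.μ t).val

end RealDivGrading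

/-!
Let `D` be a central real algebra of finite dimension with a division grading whose components are
lines. The support is finite and closed under addition, hence a subgroup `T`. Homogeneous elements
commute up to a real scalar, which is a root of unity, so it is `±1`; hence squares of homogeneous
elements are central, that is, scalars, and `2T = 0`. After rescaling, a basis `X t ∈ D_t` satisfies
`X u * X v = ± X (u + v)` and `X t ^ 2 = (-1) ^ μ(t)` (`IsDivGradingDimOne.exists_realizes`). Such a
basis is called a realization of `μ`. The commutation signs show that `μ` is a quadratic form, and
it has type I because `D` is central (`Realizes.isTypeI`).

Two facts reduce everything to quadratic forms over `𝔽₂`. First, two realizations of the same form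
are isomorphic up to signs (`Realizes.exists_algEquiv`): their cocycles differ by a symmetric
cocycle that is constant on the diagonal, and the corresponding extension of `T` by `𝔽₂` is elementary
abelian, so it splits. Secondly, forms of type I are classified by the size of the space and the
Gauss sum `∑ v, (-1) ^ Q v` (`IsTypeI.isometryEquiv_of_gauss`), which in a symplectic basis is seen
to be `2ᵏ` times the sign of the Arf invariant (`HasArf.card_and_gauss`); in particular the Arf
invariant is well defined.

The standard tensor products realize a form of each possible size and Arf invariant
(`IsModel.tensorM2R`). Hence a form realized in `D` determines the algebra `D`: it is a matrix
algebra over `ℝ` if the Arf invariant is `0` and over `ℍ` if it is `1`. These are not isomorphic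
(`isEmpty_algEquiv_matrix`), so conversely `D` determines the Arf invariant
(`Realizes.hasArf_zero`, `Realizes.hasArf_one`). Given the Arf invariant, every pair `(T, μ)` is
isometric to a standard form, whose realization, transported to `D`, is the required grading.
-/

namespace RealDivGrading

/-! ### Signs -/

/-- The character `0 ↦ 1`, `1 ↦ -1` of `𝔽₂`, with integer values so that it acts on every ring. -/
def sgn (a : ZMod 2) : ℤ := (-1) ^ a.val

@[simp] lemma sgn_zero : sgn 0 = 1 := rfl

@[simp] lemma sgn_one : sgn 1 = -1 := rfl

lemma sgn_add : ∀ a b : ZMod 2, sgn (a + b) = sgn a * sgn b := by decide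

lemma sgn_mul_self : ∀ a : ZMod 2, sgn a * sgn a = 1 := by decide

lemma sgn_injective : Function.Injective sgn := by
  intro a b
  revert a b
  decide

lemma sgn_sum {ι : Type*} (s : Finset ι) (f : ι → ZMod 2) :
    sgn (∑ i ∈ s, f i) = ∏ i ∈ s, sgn (f i) := by
  classical
  induction s using Finset.induction_on with
  | empty => simp
  | insert i s hi ih => rw [Finset.sum_insert hi, Finset.prod_insert hi, sgn_add, ih]

lemma zmod_two_cases : ∀ a : ZMod 2, a = 0 ∨ a = 1 := by decide

/-! ### Quadratic forms over `𝔽₂` -/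

section Forms

variable {V W : Type*} [AddCommGroup V] [Module (ZMod 2) V] [AddCommGroup W] [Module (ZMod 2) W]

/-- The form `p x² + q y² + x y` on `𝔽₂²`. -/
def plane (p q : ZMod 2) : QuadraticForm (ZMod 2) (ZMod 2 × ZMod 2) :=
  QuadraticMap.ofPolar (fun x => p * (x.1 * x.1) + q * (x.2 * x.2) + x.1 * x.2)
    (fun a x => by simp only [Prod.smul_fst, Prod.smul_snd, smul_eq_mul]; ring)
    (fun x y z => by simp only [QuadraticMap.polar, Prod.fst_add, Prod.snd_add]; ring)
    (fun a x y => by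
      simp only [QuadraticMap.polar, Prod.fst_add, Prod.snd_add, Prod.smul_fst, Prod.smul_snd,
        smul_eq_mul]
      ring)

lemma plane_apply (p q : ZMod 2) (x : ZMod 2 × ZMod 2) :
    plane p q x = p * (x.1 * x.1) + q * (x.2 * x.2) + x.1 * x.2 := rfl

lemma polar_self_eq_zero (Q : QuadraticForm (ZMod 2) V) (v : V) : QuadraticMap.polar Q v v = 0 := by
  rw [QuadraticMap.polar_self, two_smul, CharTwo.add_self_eq_zero]

lemma map_add_eq (Q : QuadraticForm (ZMod 2) V) (u v : V) :
    Q (u + v) = Q u + Q v + QuadraticMap.polar Q u v := by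
  rw [QuadraticMap.polar]; ring

/-- The Gauss sum of a function with values in `𝔽₂`. For a form of type I on a space of dimension
`2k` it is `2ᵏ` or `-2ᵏ`, according to the Arf invariant. -/
def gauss [Fintype V] (Q : V → ZMod 2) : ℤ := ∑ v, sgn (Q v)

lemma gauss_plane : ∀ p q : ZMod 2, gauss (plane p q) = 2 * sgn (p * q) := by
  decide

lemma gauss_prod [Fintype V] [Fintype W] (Q : QuadraticForm (ZMod 2) V)
    (R : QuadraticForm (ZMod 2) W) : gauss (Q.prod R) = gauss Q * gauss R := by
  simp only [gauss, Fintype.sum_prod_type, Finset.sum_mul_sum, QuadraticMap.prod_apply, sgn_add]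

lemma gauss_congr [Fintype V] [Fintype W] {Q : QuadraticForm (ZMod 2) V}
    {R : QuadraticForm (ZMod 2) W} (e : Q.IsometryEquiv R) : gauss Q = gauss R :=
  Fintype.sum_equiv e.toEquiv _ _ fun v => by
    rw [show R (e.toEquiv v) = Q v from e.map_app v]

lemma IsTypeI.of_isometryEquiv {Q : QuadraticForm (ZMod 2) V} {R : QuadraticForm (ZMod 2) W}
    (hR : IsTypeI R) (e : Q.IsometryEquiv R) : IsTypeI Q := by
  intro v hv
  have h : e v = 0 := hR _ fun u => by
    obtain ⟨u, rfl⟩ := e.toLinearEquiv.surjective u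
    have := hv u
    rw [QuadraticMap.polar, ← e.map_app, ← e.map_app, ← e.map_app, map_add] at this
    exact this
  exact e.toLinearEquiv.map_eq_zero_iff.1 h

lemma IsTypeI.of_prod {Q : QuadraticForm (ZMod 2) V} {R : QuadraticForm (ZMod 2) W}
    (h : IsTypeI (Q.prod R)) : IsTypeI R := by
  intro w hw
  have := h (0, w) fun u => by
    rw [QuadraticMap.polar_prod]
    simp [hw]
  exact (Prod.ext_iff.1 this).2

lemma IsTypeI.exists_polar_eq_one {Q : QuadraticForm (ZMod 2) V} (h : IsTypeI Q) {a : V}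
    (ha : a ≠ 0) : ∃ b, QuadraticMap.polar Q a b = 1 := by
  by_contra! hb
  refine ha (h a fun u => ?_)
  rw [QuadraticMap.polar_comm]
  exact (zmod_two_cases _).resolve_right (hb u)

/-- The orthogonal complement of two vectors for the polar form. -/
def orthPair (Q : QuadraticForm (ZMod 2) V) (a b : V) : Submodule (ZMod 2) V :=
  LinearMap.ker (Q.polarBilin a) ⊓ LinearMap.ker (Q.polarBilin b)

lemma mem_orthPair {Q : QuadraticForm (ZMod 2) V} {a b u : V} :
    u ∈ orthPair Q a b ↔ QuadraticMap.polar Q a u = 0 ∧ QuadraticMap.polar Q b u = 0 := by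
  simp [orthPair]

/-- A nonorthogonal pair `a, b` splits off as an orthogonal summand. -/
theorem exists_plane_prod_isometryEquiv (Q : QuadraticForm (ZMod 2) V) {a b : V}
    (hab : QuadraticMap.polar Q a b = 1) :
    Nonempty (QuadraticMap.IsometryEquiv
      ((plane (Q a) (Q b)).prod (Q.comp (orthPair Q a b).subtype)) Q) := by
  have hba : QuadraticMap.polar Q b a = 1 := by rwa [QuadraticMap.polar_comm]
  have hu (u : orthPair Q a b) := mem_orthPair.1 u.2
  let f : ((ZMod 2 × ZMod 2) × orthPair Q a b) →ₗ[ZMod 2] V :=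
    ((LinearMap.toSpanSingleton (ZMod 2) V a).coprod
      (LinearMap.toSpanSingleton (ZMod 2) V b)).coprod (orthPair Q a b).subtype
  have hf (p u) : f (p, u) = p.1 • a + p.2 • b + u := rfl
  have hpa (p) (u : orthPair Q a b) : QuadraticMap.polar Q a (f (p, u)) = p.2 := by
    rw [hf, QuadraticMap.polar_add_right, QuadraticMap.polar_add_right,
      QuadraticMap.polar_smul_right, QuadraticMap.polar_smul_right, (hu u).1, hab,
      polar_self_eq_zero]
    simp
  have hpb (p) (u : orthPair Q a b) : QuadraticMap.polar Q b (f (p, u)) = p.1 := by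
    rw [hf, QuadraticMap.polar_add_right, QuadraticMap.polar_add_right,
      QuadraticMap.polar_smul_right, QuadraticMap.polar_smul_right, (hu u).2, hba,
      polar_self_eq_zero]
    simp
  have hbij : Function.Bijective f := by
    constructor
    · rintro ⟨p, u⟩ ⟨p', u'⟩ h
      have h1 : p = p' := by
        refine Prod.ext ?_ ?_
        · rw [← hpb p u, h, hpb]
        · rw [← hpa p u, h, hpa]
      subst h1
      rw [hf, hf] at h
      simpa using h
    · intro v
      refine ⟨((QuadraticMap.polar Q b v, QuadraticMap.polar Q a v),
        ⟨v - QuadraticMap.polar Q b v • a - QuadraticMap.polar Q a v • b,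
          mem_orthPair.2 ⟨?_, ?_⟩⟩), ?_⟩
      · simp [QuadraticMap.polar_sub_right, QuadraticMap.polar_smul_right, CharTwo.two_eq_zero, hab]
      · simp [QuadraticMap.polar_sub_right, QuadraticMap.polar_smul_right, CharTwo.two_eq_zero, hba]
      · rw [hf]
        simp only
        abel
  refine ⟨⟨LinearEquiv.ofBijective f hbij, ?_⟩⟩
  rintro ⟨p, u⟩
  change Q (f (p, u)) = plane (Q a) (Q b) p + Q u
  have hbu := (hu u).2
  have hau := (hu u).1
  rw [hf, map_add_eq, map_add_eq, QuadraticMap.polar_add_left, QuadraticMap.polar_smul_left,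
    QuadraticMap.polar_smul_left, QuadraticMap.polar_smul_left, QuadraticMap.polar_smul_right,
    hau, hbu, hab, QuadraticMap.map_smul, QuadraticMap.map_smul, plane_apply]
  simp only [smul_eq_mul]
  ring

/-! ### Symplectic bases and the Arf invariant -/

lemma hasArf_of_basis {ι : Type*} [Fintype ι] [DecidableEq ι] {Q : QuadraticForm (ZMod 2) V}
    (B : Module.Basis (ι ⊕ ι) (ZMod 2) V)
    (h1 : ∀ i j, QuadraticMap.polar Q (B (.inl i)) (B (.inl j)) = 0)
    (h2 : ∀ i j, QuadraticMap.polar Q (B (.inr i)) (B (.inr j)) = 0)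
    (h3 : ∀ i j, QuadraticMap.polar Q (B (.inl i)) (B (.inr j)) = if i = j then 1 else 0) :
    HasArf Q (∑ i, Q (B (.inl i)) * Q (B (.inr i))) := by
  let e := Fintype.equivFin ι
  refine ⟨_, B.reindex (Equiv.sumCongr e e), ⟨?_, ?_, ?_⟩, ?_⟩
  · simp [h1]
  · simp [h2]
  · simp [h3]
  · simp only [Module.Basis.reindex_apply, Equiv.sumCongr_symm, Equiv.sumCongr_apply, Sum.map_inl,
      Sum.map_inr]
    exact Equiv.sum_comp e.symm fun i => Q (B (.inl i)) * Q (B (.inr i))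

lemma HasArf.of_isometryEquiv {Q : QuadraticForm (ZMod 2) V} {R : QuadraticForm (ZMod 2) W}
    {ε : ZMod 2} (h : HasArf Q ε) (e : Q.IsometryEquiv R) : HasArf R ε := by
  obtain ⟨m, B, hB, hε⟩ := h
  have hp (u v) : QuadraticMap.polar R (e u) (e v) = QuadraticMap.polar Q u v := by
    rw [QuadraticMap.polar, ← map_add, e.map_app, e.map_app, e.map_app]
    rfl
  have hm (i) : B.map e.toLinearEquiv i = e (B i) := rfl
  refine ⟨m, B.map e.toLinearEquiv, ⟨?_, ?_, ?_⟩, ?_⟩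
  · intro i j; rw [hm, hm, hp, hB.inl_inl]
  · intro i j; rw [hm, hm, hp, hB.inr_inr]
  · intro i j; rw [hm, hm, hp, hB.inl_inr]
  · simpa only [hm, e.map_app] using hε

lemma HasArf.plane_prod {Q : QuadraticForm (ZMod 2) V} {ε : ZMod 2} (h : HasArf Q ε)
    (p q : ZMod 2) : HasArf ((plane p q).prod Q) (p * q + ε) := by
  obtain ⟨m, B, hB, rfl⟩ := h
  let P : Module.Basis (Unit ⊕ Unit) (ZMod 2) (ZMod 2 × ZMod 2) :=
    (Module.Basis.singleton Unit (ZMod 2)).prod (Module.Basis.singleton Unit (ZMod 2))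
  have hP1 (i) : P (.inl i) = (1, 0) := by simp [P]
  have hP2 (i) : P (.inr i) = (0, 1) := by simp [P]
  have hpl : QuadraticMap.polar (plane p q) (1, 0) (0, 1) = 1 := by
    simp only [QuadraticMap.polar, plane_apply, Prod.fst_add, Prod.snd_add]
    ring
  let C : Module.Basis ((Unit ⊕ Fin m) ⊕ (Unit ⊕ Fin m)) (ZMod 2) ((ZMod 2 × ZMod 2) × V) :=
    (P.prod B).reindex (Equiv.sumSumSumComm Unit Unit (Fin m) (Fin m))
  have hC1 (i) : C (.inl (.inl i)) = ((1, 0), 0) := by simp [C, hP1]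
  have hC2 (i) : C (.inr (.inl i)) = ((0, 1), 0) := by simp [C, hP2]
  have hC3 (i) : C (.inl (.inr i)) = (0, B (.inl i)) := by simp [C]
  have hC4 (i) : C (.inr (.inr i)) = (0, B (.inr i)) := by simp [C]
  have := hasArf_of_basis (Q := (plane p q).prod Q) C ?_ ?_ ?_
  · convert this using 1
    simp [hC1, hC2, hC3, hC4, plane_apply]
  · rintro (i | i) (j | j) <;> rw [QuadraticMap.polar_prod] <;>
      simp [hC1, hC3, hB.inl_inl, CharTwo.two_eq_zero]
  · rintro (i | i) (j | j) <;> rw [QuadraticMap.polar_prod] <;>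
      simp [hC2, hC4, hB.inr_inr, CharTwo.two_eq_zero]
  · rintro (i | i) (j | j) <;> rw [QuadraticMap.polar_prod] <;>
      simp [hC1, hC2, hC3, hC4, hB.inl_inr, hpl]

lemma hasArf_zero_of_subsingleton [Subsingleton V] (Q : QuadraticForm (ZMod 2) V) :
    HasArf Q 0 :=
  ⟨0, Module.Basis.empty V, ⟨fun i => i.elim0, fun i => i.elim0, fun i => i.elim0⟩, by simp⟩

theorem card_orthPair [Finite V] (Q : QuadraticForm (ZMod 2) V) {a b : V}
    (hab : QuadraticMap.polar Q a b = 1) : Nat.card V = 4 * Nat.card (orthPair Q a b) := by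
  obtain ⟨e⟩ := exists_plane_prod_isometryEquiv Q hab
  rw [← Nat.card_congr e.toEquiv, Nat.card_prod, Nat.card_prod]
  simp

lemma isTypeI_orthPair {Q : QuadraticForm (ZMod 2) V} (hQ : IsTypeI Q) {a b : V}
    (hab : QuadraticMap.polar Q a b = 1) : IsTypeI (Q.comp (orthPair Q a b).subtype) := by
  obtain ⟨e⟩ := exists_plane_prod_isometryEquiv Q hab
  exact (hQ.of_isometryEquiv e).of_prod

theorem IsTypeI.exists_hasArf {V : Type*} [AddCommGroup V] [Module (ZMod 2) V] [Finite V]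
    {Q : QuadraticForm (ZMod 2) V} (hQ : IsTypeI Q) : ∃ ε, HasArf Q ε := by
  induction hn : Nat.card V using Nat.strong_induction_on generalizing V with
  | _ n ih =>
    cases subsingleton_or_nontrivial V with
    | inl _ => exact ⟨0, hasArf_zero_of_subsingleton Q⟩
    | inr _ =>
      obtain ⟨a, ha⟩ := exists_ne (0 : V)
      obtain ⟨b, hab⟩ := hQ.exists_polar_eq_one ha
      have hc := card_orthPair Q hab
      have hpos : 0 < Nat.card (orthPair Q a b) := Nat.card_pos
      obtain ⟨ε, h⟩ := ih (Nat.card (orthPair Q a b)) (by omega) (isTypeI_orthPair hQ hab) rfl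
      obtain ⟨e⟩ := exists_plane_prod_isometryEquiv Q hab
      exact ⟨_, (h.plane_prod _ _).of_isometryEquiv e⟩

lemma IsSymplectic.apply_sum {Q : QuadraticForm (ZMod 2) V} {m : ℕ}
    {B : Module.Basis (Fin m ⊕ Fin m) (ZMod 2) V} (hB : IsSymplectic Q B)
    (w : Fin m → ZMod 2 × ZMod 2) (s : Finset (Fin m)) :
    Q (∑ i ∈ s, ((w i).1 • B (.inl i) + (w i).2 • B (.inr i))) =
      ∑ i ∈ s, plane (Q (B (.inl i))) (Q (B (.inr i))) (w i) := by
  have hBr (i j) : QuadraticMap.polar Q (B (.inr i)) (B (.inl j)) = if j = i then 1 else 0 := by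
    rw [QuadraticMap.polar_comm, hB.inl_inr]
  induction s using Finset.induction_on with
  | empty => simp
  | insert i s hi ih =>
    have h0 : QuadraticMap.polar Q ((w i).1 • B (.inl i) + (w i).2 • B (.inr i))
        (∑ j ∈ s, ((w j).1 • B (.inl j) + (w j).2 • B (.inr j))) = 0 := by
      rw [← QuadraticMap.polarBilin_apply_apply, map_sum]
      refine Finset.sum_eq_zero fun j hj => ?_
      have hij : i ≠ j := fun h => hi (h ▸ hj)
      simp [QuadraticMap.polar_add_right, QuadraticMap.polar_smul_right, hB.inl_inl, hB.inr_inr,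
        hB.inl_inr, hBr, hij, hij.symm]
    rw [Finset.sum_insert hi, Finset.sum_insert hi, map_add_eq, h0, ih, map_add_eq,
      QuadraticMap.polar_smul_left, QuadraticMap.polar_smul_right, hB.inl_inr,
      QuadraticMap.map_smul, QuadraticMap.map_smul, plane_apply]
    simp only [smul_eq_mul, if_true]
    ring

lemma HasArf.card_and_gauss [Fintype V] {Q : QuadraticForm (ZMod 2) V} {ε : ZMod 2}
    (h : HasArf Q ε) : ∃ m : ℕ, Nat.card V = 4 ^ m ∧ gauss Q = 2 ^ m * sgn ε ∧
      (m = 0 → ε = 0) := by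
  obtain ⟨m, B, hB, rfl⟩ := h
  let e : V ≃ (Fin m → ZMod 2 × ZMod 2) := B.equivFun.toEquiv.trans
    ((Equiv.sumArrowEquivProdArrow _ _ _).trans (Equiv.arrowProdEquivProdArrow _ _ _).symm)
  have he (v i) : e v i = (B.repr v (.inl i), B.repr v (.inr i)) := rfl
  refine ⟨m, ?_, ?_, ?_⟩
  · rw [Nat.card_congr e]
    simp
  · have hv (v) : sgn (Q v) =
        ∏ i, sgn (plane (Q (B (.inl i))) (Q (B (.inr i))) (e v i)) := by
      rw [← sgn_sum, ← hB.apply_sum (e v) Finset.univ]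
      congr 2
      conv_lhs => rw [← B.sum_repr v]
      rw [Fintype.sum_sum_type, Finset.sum_add_distrib]
      rfl
    have hs := Finset.prod_univ_sum (fun _ : Fin m => (Finset.univ : Finset (ZMod 2 × ZMod 2)))
      (fun i p => sgn (plane (Q (B (.inl i))) (Q (B (.inr i))) p))
    rw [Fintype.piFinset_univ] at hs
    rw [gauss, Fintype.sum_equiv e _ (fun w => ∏ i, sgn (plane (Q (B (.inl i)))
      (Q (B (.inr i))) (w i))) hv, ← hs, sgn_sum]
    have hp (i : Fin m) : ∑ p, sgn (plane (Q (B (.inl i))) (Q (B (.inr i))) p) =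
        2 * sgn (Q (B (.inl i)) * Q (B (.inr i))) := gauss_plane _ _
    simp only [hp, Finset.prod_mul_distrib]
    simp
  · rintro rfl
    simp

lemma HasArf.unique [Finite V] {Q : QuadraticForm (ZMod 2) V} {ε ε' : ZMod 2}
    (h : HasArf Q ε) (h' : HasArf Q ε') : ε = ε' := by
  cases nonempty_fintype V
  obtain ⟨m, hm, hg, -⟩ := h.card_and_gauss
  obtain ⟨m', hm', hg', -⟩ := h'.card_and_gauss
  have : m = m' := Nat.pow_right_injective (le_refl 2 |>.trans (by norm_num)) (hm.symm.trans hm')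
  subst this
  exact sgn_injective (mul_left_cancel₀ (by positivity) (hg.symm.trans hg'))

/-! ### Classification of forms of type I -/

lemma anisotropic_iff_gauss [Fintype V] (Q : QuadraticForm (ZMod 2) V) :
    (∀ v, v ≠ 0 → Q v = 1) ↔ gauss Q + Nat.card V = 2 := by
  classical
  have h : gauss Q + Nat.card V = 2 + ∑ v ∈ Finset.univ.erase (0 : V), (sgn (Q v) + 1) := by
    have h1 : gauss Q + Nat.card V = ∑ v : V, (sgn (Q v) + 1) := by
      rw [Finset.sum_add_distrib]
      simp [gauss]
    rw [h1, ← Finset.add_sum_erase _ _ (Finset.mem_univ (0 : V))]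
    simp
  have hnn : ∀ a : ZMod 2, 0 ≤ sgn a + 1 := by decide
  have hz : ∀ a : ZMod 2, sgn a + 1 = 0 ↔ a = 1 := by decide
  rw [h, add_eq_left, Finset.sum_eq_zero_iff_of_nonneg fun v _ => hnn _]
  simp [hz]

/-- A nonzero isotropic vector lies in a hyperbolic plane. -/
lemma IsTypeI.exists_hyperbolic_pair {Q : QuadraticForm (ZMod 2) V} (h : IsTypeI Q) {a : V}
    (ha : a ≠ 0) (hQa : Q a = 0) : ∃ b, QuadraticMap.polar Q a b = 1 ∧ Q b = 0 := by
  obtain ⟨b, hb⟩ := h.exists_polar_eq_one ha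
  rcases zmod_two_cases (Q b) with h0 | h1
  · exact ⟨b, hb, h0⟩
  · refine ⟨a + b, ?_, ?_⟩
    · rw [QuadraticMap.polar_add_right, polar_self_eq_zero, hb, zero_add]
    · rw [map_add_eq, hQa, h1, hb]
      decide

/-- Forms of type I on spaces of the same size with the same Gauss sum are isometric: hyperbolic
planes are split off as long as there are nonzero isotropic vectors, which the Gauss sum detects;
an anisotropic form takes the value `1` on all nonzero vectors. -/
theorem IsTypeI.isometryEquiv_of_gauss {V W : Type*} [AddCommGroup V] [Module (ZMod 2) V]
    [AddCommGroup W] [Module (ZMod 2) W] [Fintype V] [Fintype W] {Q : QuadraticForm (ZMod 2) V}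
    {R : QuadraticForm (ZMod 2) W} (hQ : IsTypeI Q) (hR : IsTypeI R)
    (hc : Nat.card V = Nat.card W) (hg : gauss Q = gauss R) : Nonempty (Q.IsometryEquiv R) := by
  classical
  induction hn : Nat.card V using Nat.strong_induction_on generalizing V W with
  | _ n ih =>
    by_cases hV : ∀ v, v ≠ 0 → Q v = 1
    · have hW : ∀ w, w ≠ 0 → R w = 1 := by
        rwa [anisotropic_iff_gauss, ← hg, ← hc, ← anisotropic_iff_gauss]
      have hr : Module.finrank (ZMod 2) V = Module.finrank (ZMod 2) W := by
        rw [Module.natCard_eq_pow_finrank (K := ZMod 2),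
          Module.natCard_eq_pow_finrank (K := ZMod 2) (V := W)] at hc
        simpa using hc
      let e := LinearEquiv.ofFinrankEq V W hr
      refine ⟨⟨e, fun v => ?_⟩⟩
      change R (e v) = Q v
      by_cases hv : v = 0
      · simp [hv]
      · rw [hV v hv, hW _ (by simpa using hv)]
    · have hW : ¬ ∀ w, w ≠ 0 → R w = 1 := by
        rwa [anisotropic_iff_gauss, ← hg, ← hc, ← anisotropic_iff_gauss]
      push Not at hV hW
      obtain ⟨a, ha, hQa⟩ := hV
      obtain ⟨c, hc0, hRc⟩ := hW
      replace hQa := (zmod_two_cases _).resolve_right hQa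
      replace hRc := (zmod_two_cases _).resolve_right hRc
      obtain ⟨b, hab, hQb⟩ := hQ.exists_hyperbolic_pair ha hQa
      obtain ⟨d, hcd, hRd⟩ := hR.exists_hyperbolic_pair hc0 hRc
      have hU := card_orthPair Q hab
      have hU' := card_orthPair R hcd
      have hpos : 0 < Nat.card (orthPair Q a b) := Nat.card_pos
      obtain ⟨e⟩ := exists_plane_prod_isometryEquiv Q hab
      obtain ⟨e'⟩ := exists_plane_prod_isometryEquiv R hcd
      have hgU : gauss (Q.comp (orthPair Q a b).subtype) =
          gauss (R.comp (orthPair R c d).subtype) := by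
        rw [← gauss_congr e, ← gauss_congr e', gauss_prod, gauss_prod, hQa, hQb, hRc, hRd,
          gauss_plane] at hg
        exact mul_left_cancel₀ (by decide) hg
      obtain ⟨f⟩ := ih _ (by omega) (isTypeI_orthPair hQ hab) (isTypeI_orthPair hR hcd)
        (by omega) hgU rfl
      rw [hQa, hQb] at e
      rw [hRc, hRd] at e'
      exact ⟨(e.symm.trans ((QuadraticMap.IsometryEquiv.refl _).prod f)).trans e'⟩

theorem IsTypeI.isometryEquiv_of_hasArf [Finite V] [Finite W] {Q : QuadraticForm (ZMod 2) V}
    {R : QuadraticForm (ZMod 2) W} (hQ : IsTypeI Q) (hR : IsTypeI R) {ε : ZMod 2}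
    (hc : Nat.card V = Nat.card W) (hQε : HasArf Q ε) (hRε : HasArf R ε) :
    Nonempty (Q.IsometryEquiv R) := by
  cases nonempty_fintype V
  cases nonempty_fintype W
  obtain ⟨m, hm, hg, -⟩ := hQε.card_and_gauss
  obtain ⟨m', hm', hg', -⟩ := hRε.card_and_gauss
  have : m = m' :=
    Nat.pow_right_injective (le_refl 2 |>.trans (by norm_num)) (hm.symm.trans (hc.trans hm'))
  subst this
  exact hQ.isometryEquiv_of_gauss hR hc (hg.trans hg'.symm)

end Forms

/-! ### Symmetric cocycles of elementary abelian 2-groups -/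

section Cocycles

/-- The set underlying an extension of `V` by `𝔽₂`. A separate type is used because `V × ZMod 2`
carries the addition of the split extension. -/
structure TwistedSum (V : Type*) where
  fst : V
  snd : ZMod 2

variable {V : Type*} [AddCommGroup V] [Module (ZMod 2) V]

/-- The abelian extension of `V` by `𝔽₂` defined by a symmetric cocycle that vanishes on the
diagonal. -/
abbrev TwistedSum.addCommGroup (τ : V → V → ZMod 2) (symm : ∀ u v, τ u v = τ v u)
    (cocycle : ∀ u v w, τ u v + τ (u + v) w = τ v w + τ u (v + w)) (diag : ∀ u, τ u u = 0) :
    AddCommGroup (TwistedSum V) :=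
  have h0 (u : V) : τ 0 u = 0 := by
    have := cocycle 0 0 u
    simpa [diag] using this
  letI : Add (TwistedSum V) := ⟨fun x y => ⟨x.fst + y.fst, x.snd + y.snd + τ x.fst y.fst⟩⟩
  letI : Zero (TwistedSum V) := ⟨⟨0, 0⟩⟩
  letI : Neg (TwistedSum V) := ⟨id⟩
  { nsmul := nsmulRec
    zsmul := zsmulRec
    add_assoc := by
      rintro ⟨u, a⟩ ⟨v, b⟩ ⟨w, c⟩
      refine congrArg₂ TwistedSum.mk (add_assoc u v w) ?_
      change a + b + τ u v + c + τ (u + v) w = a + (b + c + τ v w) + τ u (v + w)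
      linear_combination cocycle u v w
    zero_add := by
      rintro ⟨u, a⟩
      refine congrArg₂ TwistedSum.mk (zero_add u) ?_
      change 0 + a + τ 0 u = a
      rw [h0, zero_add, add_zero]
    add_zero := by
      rintro ⟨u, a⟩
      refine congrArg₂ TwistedSum.mk (add_zero u) ?_
      change a + 0 + τ u 0 = a
      rw [symm, h0, add_zero, add_zero]
    neg_add_cancel := by
      rintro ⟨u, a⟩
      refine congrArg₂ TwistedSum.mk (ZModModule.add_self u) ?_
      change a + a + τ u u = 0
      rw [diag, CharTwo.add_self_eq_zero, add_zero]
    add_comm := by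
      rintro ⟨u, a⟩ ⟨v, b⟩
      refine congrArg₂ TwistedSum.mk (add_comm u v) ?_
      change a + b + τ u v = b + a + τ v u
      rw [symm, add_comm a b] }

/-- The extension defined by the cocycle is itself a vector space over `𝔽₂`, so it splits. -/
theorem exists_coboundary (τ : V → V → ZMod 2) (symm : ∀ u v, τ u v = τ v u)
    (cocycle : ∀ u v w, τ u v + τ (u + v) w = τ v w + τ u (v + w)) (diag : ∀ u, τ u u = 0) :
    ∃ s : V → ZMod 2, ∀ u v, s (u + v) = s u + s v + τ u v := by
  let := TwistedSum.addCommGroup τ symm cocycle diag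
  let : Module (ZMod 2) (TwistedSum V) := AddCommGroup.zmodModule fun x => by
    rw [two_nsmul]
    exact neg_add_cancel x
  let π : TwistedSum V →+ V :=
    { toFun := TwistedSum.fst, map_zero' := rfl, map_add' := fun _ _ => rfl }
  obtain ⟨σ, hσ⟩ := (π.toZModLinearMap 2).exists_rightInverse_of_surjective
    (LinearMap.range_eq_top.2 fun v => ⟨⟨v, 0⟩, rfl⟩)
  have hfst (v) : (σ v).fst = v := LinearMap.congr_fun hσ v
  refine ⟨fun v => (σ v).snd, fun u v => ?_⟩
  have h : (σ (u + v)).snd = (σ u).snd + (σ v).snd + τ (σ u).fst (σ v).fst := by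
    rw [map_add]; rfl
  exact h.trans (by rw [hfst, hfst])

end Cocycles

/-! ### Realizations of forms by bases of algebras -/

section Realizations

variable {V W : Type*} [AddCommGroup V] [AddCommGroup W]
variable {A B : Type*} [Ring A] [Algebra ℝ A] [Ring B] [Algebra ℝ B]

lemma sgn_smul_injective {x : A} (hx : x ≠ 0) : Function.Injective fun a => sgn a • x := by
  have h : x ≠ -x := fun h => hx (by
    have : (2 : ℝ) • x = 0 := by rw [two_smul]; nth_rewrite 1 [h]; exact neg_add_cancel x
    simpa using this)
  intro a b hab
  rcases zmod_two_cases a with rfl | rfl <;> rcases zmod_two_cases b with rfl | rfl <;>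
    simp_all [eq_comm]

lemma sgn_smul_sgn_smul {M : Type*} [AddCommGroup M] (a b : ZMod 2) (x : M) :
    sgn a • sgn b • x = sgn (a + b) • x := by
  rw [smul_smul, sgn_add]

/-- The basis `X` of an algebra, indexed by the group `V`, multiplies like the elements of `V` up to
signs, and `X v` squares to `(-1) ^ Q v`. -/
structure Realizes (Q : V → ZMod 2) (X : Module.Basis V ℝ A) : Prop where
  mul : ∀ u v, ∃ c : ZMod 2, X u * X v = sgn c • X (u + v)
  sq : ∀ v, X v * X v = sgn (Q v) • (1 : A)

/-- The signs in a realization: `c` is the cocycle of the products, `z` the sign of `X 0`. The form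
`Q` is, up to a constant, the restriction of `c` to the diagonal, and its polar form is the
commutator pairing. -/
theorem Realizes.exists_cocycle [Module (ZMod 2) V] {Q : V → ZMod 2} {X : Module.Basis V ℝ A}
    (h : Realizes Q X) : ∃ (c : V → V → ZMod 2) (z : ZMod 2),
      (∀ u v, X u * X v = sgn (c u v) • X (u + v)) ∧ (1 : A) = sgn z • X 0 ∧
      (∀ u v w, c u v + c (u + v) w = c v w + c u (v + w)) ∧
      (∀ u v, c u v + c v u = Q (u + v) + Q u + Q v) ∧ (∀ u, Q u = c u u + z) := by
  choose c hc using h.mul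
  have hne (v) : X v ≠ 0 := X.ne_zero v
  have h1 : (1 : A) ≠ 0 := fun h10 => hne 0 (by rw [← mul_one (X 0), h10, mul_zero])
  obtain ⟨z, hz⟩ : ∃ z, (1 : A) = sgn z • X 0 := by
    refine ⟨c 0 0 , ?_⟩
    have e1 : X 0 * X 0 * X 0 = sgn (Q 0) • X 0 := by rw [h.sq, smul_mul_assoc, one_mul]
    have e2 : X 0 * X 0 * X 0 = sgn (c 0 0 + Q 0) • (1 : A) := by
      rw [hc, add_zero, smul_mul_assoc, h.sq, sgn_smul_sgn_smul]
    have e3 : sgn (Q 0) • sgn (Q 0) • X 0 = sgn (Q 0) • sgn (c 0 0 + Q 0) • (1 : A) := by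
      rw [← e1, e2]
    rw [sgn_smul_sgn_smul, sgn_smul_sgn_smul, CharTwo.add_self_eq_zero, sgn_zero, one_smul,
      add_comm (c 0 0), ← add_assoc, CharTwo.add_self_eq_zero, zero_add] at e3
    rw [e3, sgn_smul_sgn_smul, CharTwo.add_self_eq_zero, sgn_zero, one_smul]
  refine ⟨c, z, hc, hz, fun u v w => ?_, fun u v => ?_, fun u => ?_⟩
  · apply sgn_smul_injective (hne (u + v + w))
    change sgn _ • X _ = sgn _ • X _
    have := mul_assoc (X u) (X v) (X w)
    rwa [hc, hc v w, smul_mul_assoc, mul_smul_comm, hc, hc, sgn_smul_sgn_smul, sgn_smul_sgn_smul,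
      ← add_assoc u v w] at this
  · have e1 : X u * X v * (X v * X u) = sgn (Q v + Q u) • (1 : A) := by
      rw [mul_assoc, ← mul_assoc (X v), h.sq, smul_mul_assoc, one_mul, mul_smul_comm, h.sq,
        sgn_smul_sgn_smul]
    rw [hc, hc, add_comm v u, smul_mul_assoc, mul_smul_comm, h.sq, sgn_smul_sgn_smul,
      sgn_smul_sgn_smul] at e1
    have := sgn_smul_injective h1 e1
    generalize c u v = x1 at this ⊢
    generalize c v u = x2 at this ⊢
    generalize Q u = x3 at this ⊢
    generalize Q v = x4 at this ⊢
    generalize Q (u + v) = x5 at this ⊢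
    revert x1 x2 x3 x4 x5
    decide
  · have e := h.sq u
    rw [hc, ZModModule.add_self, hz, sgn_smul_sgn_smul] at e
    have := sgn_smul_injective (hne 0) e
    rw [this, add_assoc, CharTwo.add_self_eq_zero, add_zero]

/-- Two realizations of the same form differ by an isomorphism of algebras and by signs: the
quotient of their cocycles is symmetric and constant on the diagonal, hence a coboundary. -/
theorem Realizes.exists_algEquiv [Module (ZMod 2) V] {Q : V → ZMod 2} {X : Module.Basis V ℝ A}
    {Y : Module.Basis V ℝ B} (hX : Realizes Q X) (hY : Realizes Q Y) :
    ∃ φ : A ≃ₐ[ℝ] B, ∀ v, ∃ s : ZMod 2, φ (X v) = sgn s • Y v := by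
  obtain ⟨c, z, hc, -, hcc, hcs, hcd⟩ := hX.exists_cocycle
  obtain ⟨c', z', hc', -, hcc', hcs', hcd'⟩ := hY.exists_cocycle
  have h2 : (2 : ZMod 2) = 0 := rfl
  obtain ⟨s, hs⟩ := exists_coboundary (fun u v => c u v + c' u v + (z + z'))
    (fun u v => by linear_combination hcs u v - hcs' u v + (c' u v - c v u) * h2)
    (fun u v w => by linear_combination hcc u v w + hcc' u v w)
    (fun u => by linear_combination hcd' u - hcd u + (c' u u + z') * h2)
  let t (v : V) : ZMod 2 := s v + (z + z')
  have ht (u v) : t (u + v) = t u + t v + c u v + c' u v := by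
    simp only [t]
    linear_combination hs u v
  let L : A →ₗ[ℝ] B := X.constr ℝ fun v => sgn (t v) • Y v
  let L' : B →ₗ[ℝ] A := Y.constr ℝ fun v => sgn (t v) • X v
  have hL (v) : L (X v) = sgn (t v) • Y v := X.constr_basis ℝ _ v
  have hL' (v) : L' (Y v) = sgn (t v) • X v := Y.constr_basis ℝ _ v
  let e : A ≃ₗ[ℝ] B := LinearEquiv.ofLinearMap L L'
    (Y.ext fun v => by
      rw [LinearMap.comp_apply, hL', map_zsmul, hL, sgn_smul_sgn_smul, CharTwo.add_self_eq_zero]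
      simp)
    (X.ext fun v => by
      rw [LinearMap.comp_apply, hL, map_zsmul, hL', sgn_smul_sgn_smul, CharTwo.add_self_eq_zero]
      simp)
  have hmul' : (LinearMap.mul ℝ A).compr₂ L = (LinearMap.mul ℝ B).compl₁₂ L L :=
    X.ext fun u => X.ext fun v => by
      change L (X u * X v) = L (X u) * L (X v)
      rw [hc, map_zsmul, hL, hL, hL, smul_mul_assoc, mul_smul_comm, hc', sgn_smul_sgn_smul,
        sgn_smul_sgn_smul, sgn_smul_sgn_smul, ht]
      congr 2
      linear_combination c u v * h2
  have hmul (x y : A) : e (x * y) = e x * e y := LinearMap.congr_fun₂ hmul' x y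
  refine ⟨AlgEquiv.ofLinearEquiv e ?_ hmul, fun v => ⟨t v, hL v⟩⟩
  have := hmul (e.symm 1) 1
  rwa [mul_one, e.apply_symm_apply, one_mul, eq_comm] at this

theorem Realizes.exists_quadraticForm [Module (ZMod 2) V] {Q : V → ZMod 2}
    {X : Module.Basis V ℝ A} (h : Realizes Q X) :
    ∃ R : QuadraticForm (ZMod 2) V, ∀ v, R v = Q v := by
  obtain ⟨c, z, -, -, hcc, hcs, hcd⟩ := h.exists_cocycle
  have h2 : (2 : ZMod 2) = 0 := rfl
  have hp (u v) : QuadraticMap.polar Q u v = c u v + c v u := by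
    rw [QuadraticMap.polar]
    linear_combination - hcs u v - (Q u + Q v) * h2
  have hadd (u v w) : QuadraticMap.polar Q (u + v) w =
      QuadraticMap.polar Q u w + QuadraticMap.polar Q v w := by
    rw [hp, hp, hp]
    have e2 := hcc w u v
    have e3 := hcc u w v
    rw [add_comm w u] at e2
    rw [add_comm w v] at e3
    linear_combination hcc u v w - e2 + e3 + (c u (v + w) - c u w - c u v) * h2
  have h0 (v) : QuadraticMap.polar Q 0 v = 0 := by
    have := hadd 0 0 v
    rw [add_zero] at this
    linear_combination - this
  have hQ0 : Q 0 = 0 := by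
    have := h0 0
    rw [QuadraticMap.polar, add_zero] at this
    linear_combination - this
  refine ⟨QuadraticMap.ofPolar Q (fun a v => ?_) hadd (fun a u v => ?_), fun _ => rfl⟩
  · rcases zmod_two_cases a with rfl | rfl <;> simp [hQ0]
  · rcases zmod_two_cases a with rfl | rfl <;> simp [h0]

theorem Realizes.isTypeI [Module (ZMod 2) V] [Algebra.IsCentral ℝ A] {Q : QuadraticForm (ZMod 2) V}
    {X : Module.Basis V ℝ A} (h : Realizes Q X) : IsTypeI Q := by
  obtain ⟨c, z, hc, hz, -, hcs, -⟩ := h.exists_cocycle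
  intro v hv
  have hcomm (u) : X u * X v = X v * X u := by
    rw [hc, hc, add_comm v u]
    congr 2
    have := hcs u v
    rw [map_add_eq, hv] at this
    have h2 : (2 : ZMod 2) = 0 := rfl
    linear_combination this + (Q u + Q v - c v u) * h2
  have hcen : X v ∈ Subalgebra.center ℝ A := by
    rw [Subalgebra.mem_center_iff]
    intro y
    have : LinearMap.mulRight ℝ (X v) = LinearMap.mulLeft ℝ (X v) := X.ext hcomm
    exact LinearMap.congr_fun this y
  obtain ⟨r, hr⟩ := (Algebra.IsCentral.mem_center_iff ℝ).1 hcen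
  by_contra hv0
  rw [Algebra.algebraMap_eq_smul_one, hz, ← Int.cast_smul_eq_zsmul ℝ, smul_smul] at hr
  have := congrArg (fun x => X.repr x v) hr
  simp [Ne.symm hv0] at this

lemma Realizes.tensorProduct {Q : V → ZMod 2} {X : Module.Basis V ℝ A} {R : W → ZMod 2}
    {Y : Module.Basis W ℝ B} (hX : Realizes Q X) (hY : Realizes R Y) :
    Realizes (fun p : V × W => Q p.1 + R p.2) (X.tensorProduct Y) := by
  refine ⟨fun u v => ?_, fun v => ?_⟩
  · obtain ⟨c, hc⟩ := hX.mul u.1 v.1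
    obtain ⟨d, hd⟩ := hY.mul u.2 v.2
    refine ⟨c + d, ?_⟩
    rw [Module.Basis.tensorProduct_apply', Module.Basis.tensorProduct_apply',
      Module.Basis.tensorProduct_apply', Algebra.TensorProduct.tmul_mul_tmul, hc, hd,
      TensorProduct.tmul_smul, ← TensorProduct.smul_tmul', sgn_smul_sgn_smul, add_comm d]
    rfl
  · rw [Module.Basis.tensorProduct_apply', Algebra.TensorProduct.tmul_mul_tmul, hX.sq, hY.sq,
      TensorProduct.tmul_smul, ← TensorProduct.smul_tmul', sgn_smul_sgn_smul, add_comm (R v.2)]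
    rfl

lemma Realizes.map {Q : V → ZMod 2} {X : Module.Basis V ℝ A} (hX : Realizes Q X)
    (φ : A ≃ₐ[ℝ] B) : Realizes Q (X.map φ.toLinearEquiv) := by
  refine ⟨fun u v => ?_, fun v => ?_⟩
  · obtain ⟨c, hc⟩ := hX.mul u v
    refine ⟨c, ?_⟩
    simp only [Module.Basis.map_apply, AlgEquiv.toLinearEquiv_apply]
    rw [← map_mul, hc, map_zsmul]
  · simp only [Module.Basis.map_apply, AlgEquiv.toLinearEquiv_apply]
    rw [← map_mul, hX.sq, map_zsmul, map_one]

lemma Realizes.reindex {Q : V → ZMod 2} {X : Module.Basis V ℝ A} (hX : Realizes Q X)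
    (e : V ≃+ W) : Realizes (fun w => Q (e.symm w)) (X.reindex e.toEquiv) := by
  refine ⟨fun u v => ?_, fun v => ?_⟩
  · obtain ⟨c, hc⟩ := hX.mul (e.symm u) (e.symm v)
    refine ⟨c, ?_⟩
    rw [← map_add] at hc
    simpa using hc
  · simpa using hX.sq (e.symm v)

/-! ### Realizations and gradings -/

variable {G : Type*} [AddCommGroup G]

/-- The subspaces of `A` spanned by the elements of a basis of given degree, where `ι v` is the
degree of `X v`. -/
def basisComp (ι : V →+ G) (X : Module.Basis V ℝ A) (g : G) : Submodule ℝ A :=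
  Submodule.span ℝ (X '' (ι ⁻¹' {g}))

lemma basisComp_apply {ι : V →+ G} (hι : Function.Injective ι) (X : Module.Basis V ℝ A) (v : V) :
    basisComp ι X (ι v) = Submodule.span ℝ {X v} := by
  have : ι ⁻¹' {ι v} = {v} := by ext; simp [hι.eq_iff]
  rw [basisComp, this, Set.image_singleton]

lemma basisComp_of_notMem (ι : V →+ G) (X : Module.Basis V ℝ A) {g : G}
    (hg : g ∉ Set.range ι) : basisComp ι X g = ⊥ := by
  have : ι ⁻¹' {g} = ∅ := Set.preimage_singleton_eq_empty.2 hg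
  rw [basisComp, this, Set.image_empty, Submodule.span_empty]

lemma support_basisComp {ι : V →+ G} (hι : Function.Injective ι) (X : Module.Basis V ℝ A) :
    support (basisComp ι X) = Set.range ι := by
  ext g
  constructor
  · intro hg
    by_contra h
    exact hg (basisComp_of_notMem ι X h)
  · rintro ⟨v, rfl⟩
    change basisComp ι X (ι v) ≠ ⊥
    rw [basisComp_apply hι, Ne, Submodule.span_singleton_eq_bot]
    exact X.ne_zero v

theorem Realizes.isDivGradingDimOne {Q : V → ZMod 2} {X : Module.Basis V ℝ A} (hX : Realizes Q X)
    {ι : V →+ G} (hι : Function.Injective ι) : IsDivGradingDimOne (basisComp ι X) := by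
  have hsupp := support_basisComp hι X
  have hmem {g x} (hx : x ∈ basisComp ι X g) (hx0 : x ≠ 0) :
      ∃ v, ∃ r : ℝ, ι v = g ∧ r ≠ 0 ∧ x = r • X v := by
    have hg : g ∈ Set.range ι := by
      by_contra h
      rw [basisComp_of_notMem ι X h] at hx
      exact hx0 (by simpa using hx)
    obtain ⟨v, rfl⟩ := hg
    rw [basisComp_apply hι, Submodule.mem_span_singleton] at hx
    obtain ⟨r, rfl⟩ := hx
    exact ⟨v, r, rfl, fun h => hx0 (by rw [h, zero_smul]), rfl⟩
  refine ⟨⟨?_, ?_⟩, ?_, ?_⟩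
  · classical
    apply DirectSum.isInternal_submodule_of_iSupIndep_of_iSup_eq_top
    · intro g
      have hle : ⨆ (h : G) (_ : h ≠ g), basisComp ι X h ≤
          Submodule.span ℝ (X '' (ι ⁻¹' {g}ᶜ)) := by
        refine iSup₂_le fun h hh => Submodule.span_mono (Set.image_mono ?_)
        rintro v rfl
        exact hh
      refine Disjoint.mono_right hle (X.linearIndependent.disjoint_span_image ?_)
      exact Disjoint.preimage _ disjoint_compl_right
    · rw [eq_top_iff, ← X.span_eq, Submodule.span_le]
      rintro _ ⟨v, rfl⟩
      refine Submodule.mem_iSup_of_mem (ι v) (Submodule.subset_span ⟨v, rfl, rfl⟩)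
  · intro g h x y hx hy
    by_cases hx0 : x = 0
    · simp [hx0]
    by_cases hy0 : y = 0
    · simp [hy0]
    obtain ⟨u, r, rfl, -, rfl⟩ := hmem hx hx0
    obtain ⟨v, s, rfl, -, rfl⟩ := hmem hy hy0
    obtain ⟨c, hc⟩ := hX.mul u v
    rw [← map_add, smul_mul_assoc, mul_smul_comm, hc]
    refine Submodule.smul_mem _ _ (Submodule.smul_mem _ _ (zsmul_mem ?_ _))
    exact Submodule.subset_span ⟨u + v, rfl, rfl⟩
  · intro g x hx hx0
    obtain ⟨v, r, rfl, hr, rfl⟩ := hmem hx hx0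
    have hXv : IsUnit (X v) := by
      have hs : X v * (sgn (Q v) • X v) = 1 := by
        rw [mul_smul_comm, hX.sq, sgn_smul_sgn_smul, CharTwo.add_self_eq_zero, sgn_zero, one_smul]
      exact ⟨⟨X v, sgn (Q v) • X v, hs, by rw [smul_mul_assoc, ← mul_smul_comm, hs]⟩, rfl⟩
    exact hXv.smul (Units.mk0 r hr)
  · intro g hg
    rw [hsupp] at hg
    obtain ⟨v, rfl⟩ := hg
    rw [basisComp_apply hι]
    exact finrank_span_singleton (X.ne_zero v)

end Realizations

/-! ### Division gradings of central algebras are realizations -/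

section DivGradings

variable {G : Type*} [AddCommGroup G] {A : Type*} [Ring A] [Algebra ℝ A]
variable {𝒟 : G → Submodule ℝ A}

lemma IsGrading.iSupIndep (h : IsGrading 𝒟) : iSupIndep 𝒟 := by
  classical exact h.isInternal.submodule_iSupIndep

lemma IsGrading.iSup_eq_top (h : IsGrading 𝒟) : ⨆ g, 𝒟 g = ⊤ := by
  classical exact h.isInternal.submodule_iSup_eq_top

lemma IsGrading.degree_unique (h : IsGrading 𝒟) {g k : G} {x : A} (hg : x ∈ 𝒟 g) (hk : x ∈ 𝒟 k)
    (hx : x ≠ 0) : g = k := by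
  by_contra hne
  exact hx (Submodule.disjoint_def.1 (h.iSupIndep.pairwiseDisjoint hne) x hg hk)

lemma mem_support_of_mem {I : Type*} {ℰ : I → Submodule ℝ A} {g : I} {x : A} (hx : x ∈ ℰ g)
    (hx0 : x ≠ 0) : g ∈ support ℰ :=
  (Submodule.ne_bot_iff _).2 ⟨x, hx, hx0⟩

lemma exists_mem_of_mem_support {I : Type*} {ℰ : I → Submodule ℝ A} {g : I}
    (hg : g ∈ support ℰ) : ∃ x ∈ ℰ g, x ≠ 0 :=
  (Submodule.ne_bot_iff _).1 hg

lemma IsDivGradingDimOne.exists_smul_eq (h : IsDivGradingDimOne 𝒟) {g : G} {x y : A}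
    (hx : x ∈ 𝒟 g) (hx0 : x ≠ 0) (hy : y ∈ 𝒟 g) : ∃ r : ℝ, y = r • x := by
  have h1 := h.finrank_eq_one g (mem_support_of_mem hx hx0)
  obtain ⟨r, hr⟩ := (finrank_eq_one_iff_of_nonzero' (⟨x, hx⟩ : 𝒟 g)
    (fun h0 => hx0 (congrArg Subtype.val h0))).1 h1 ⟨y, hy⟩
  exact ⟨r, (congrArg Subtype.val hr).symm⟩

lemma IsDivGradingDimOne.mul_ne_zero (h : IsDivGradingDimOne 𝒟) {g k : G} {x y : A}
    (hx : x ∈ 𝒟 g) (hx0 : x ≠ 0) (hy : y ∈ 𝒟 k) (hy0 : y ≠ 0) : x * y ≠ 0 := by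
  have : Nontrivial A := ⟨x, 0, hx0⟩
  exact ((h.isUnit g x hx hx0).mul (h.isUnit k y hy hy0)).ne_zero

lemma IsDivGradingDimOne.add_mem_support (h : IsDivGradingDimOne 𝒟) {g k : G}
    (hg : g ∈ support 𝒟) (hk : k ∈ support 𝒟) : g + k ∈ support 𝒟 := by
  obtain ⟨x, hx, hx0⟩ := exists_mem_of_mem_support hg
  obtain ⟨y, hy, hy0⟩ := exists_mem_of_mem_support hk
  exact mem_support_of_mem (h.mul_mem hx hy) (h.mul_ne_zero hx hx0 hy hy0)

lemma IsGrading.finite_support [FiniteDimensional ℝ A] (h : IsGrading 𝒟) :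
    (support 𝒟).Finite :=
  WellFoundedGT.finite_ne_bot_of_iSupIndep h.iSupIndep

/-- A nonempty finite set closed under addition is a subgroup. -/
theorem IsDivGradingDimOne.exists_addSubgroup [FiniteDimensional ℝ A] [Nontrivial A]
    (h : IsDivGradingDimOne 𝒟) : ∃ T : AddSubgroup G, (T : Set G) = support 𝒟 := by
  have : Finite (support 𝒟) := h.finite_support
  obtain ⟨u, hu⟩ : (support 𝒟).Nonempty := by
    by_contra hne
    rw [Set.not_nonempty_iff_eq_empty] at hne
    have hbot (g) : 𝒟 g = ⊥ := by
      by_contra hg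
      have : g ∈ support 𝒟 := hg
      rw [hne] at this
      exact this
    have := h.iSup_eq_top
    simp only [hbot, iSup_bot] at this
    exact bot_ne_top this
  have hsurj (u) (hu : u ∈ support 𝒟) (w) (hw : w ∈ support 𝒟) : ∃ v ∈ support 𝒟, u + v = w := by
    let f : support 𝒟 → support 𝒟 := fun v => ⟨u + v, h.add_mem_support hu v.2⟩
    have hf : Function.Injective f := fun v v' hv =>
      Subtype.ext (add_left_cancel (congrArg Subtype.val hv))
    obtain ⟨v, hv⟩ := Finite.surjective_of_injective hf ⟨w, hw⟩
    exact ⟨v, v.2, congrArg Subtype.val hv⟩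
  have h0 : (0 : G) ∈ support 𝒟 := by
    obtain ⟨v, hv, huv⟩ := hsurj u hu u hu
    rwa [← add_eq_left.1 huv]
  refine ⟨{ carrier := support 𝒟, add_mem' := h.add_mem_support, zero_mem' := h0,
            neg_mem' := fun {w} hw => ?_ }, rfl⟩
  obtain ⟨v, hv, hwv⟩ := hsurj w hw 0 h0
  rwa [neg_eq_of_add_eq_zero_right hwv]

lemma IsDivGradingDimOne.one_mem (h : IsDivGradingDimOne 𝒟) (h0 : (0 : G) ∈ support 𝒟) :
    (1 : A) ∈ 𝒟 0 := by
  obtain ⟨x, hx, hx0⟩ := exists_mem_of_mem_support h0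
  have hxx : x * x ∈ 𝒟 0 := by simpa using h.mul_mem hx hx
  obtain ⟨r, hr⟩ := h.exists_smul_eq hx hx0 hxx
  have hxr : x = r • 1 := (h.isUnit 0 x hx hx0).mul_left_cancel (by rw [hr, mul_smul_comm, mul_one])
  have hr0 : r ≠ 0 := fun hr0 => hx0 (by rw [hxr, hr0, zero_smul])
  have : (1 : A) = r⁻¹ • x := by rw [hxr, smul_smul, inv_mul_cancel₀ hr0, one_smul]
  rw [this]
  exact Submodule.smul_mem _ _ hx

lemma IsDivGradingDimOne.pow_mem (h : IsDivGradingDimOne 𝒟) (h0 : (0 : G) ∈ support 𝒟) {g : G}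
    {x : A} (hx : x ∈ 𝒟 g) (n : ℕ) : x ^ n ∈ 𝒟 (n • g) := by
  induction n with
  | zero => simpa using h.one_mem h0
  | succ n ih =>
    rw [pow_succ, succ_nsmul]
    exact h.mul_mem ih hx

/-- Homogeneous elements commute up to a real scalar, which is a root of unity since the degrees
have finite order. -/
theorem IsDivGradingDimOne.commute_or_anticommute [FiniteDimensional ℝ A] [Nontrivial A]
    (h : IsDivGradingDimOne 𝒟) {g k : G} {x y : A} (hx : x ∈ 𝒟 g) (hx0 : x ≠ 0) (hy : y ∈ 𝒟 k)
    (hy0 : y ≠ 0) : x * y = y * x ∨ x * y = -(y * x) := by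
  obtain ⟨T, hT⟩ := h.exists_addSubgroup
  have h0 : (0 : G) ∈ support 𝒟 := hT ▸ T.zero_mem
  have hgT : g ∈ T := by
    rw [← SetLike.mem_coe, hT]
    exact mem_support_of_mem hx hx0
  have : Finite T := by
    have := h.finite_support
    rw [← hT] at this
    exact this
  obtain ⟨n, hn, hng⟩ := isOfFinAddOrder_iff_nsmul_eq_zero.1
    (isOfFinAddOrder_of_finite (⟨g, hgT⟩ : T))
  replace hng : n • g = 0 := congrArg Subtype.val hng
  have hxy : x * y ∈ 𝒟 (k + g) := add_comm g k ▸ h.mul_mem hx hy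
  obtain ⟨β, hβ⟩ := h.exists_smul_eq (h.mul_mem hy hx) (h.mul_ne_zero hy hy0 hx hx0) hxy
  have hpow (m : ℕ) : x ^ m * y = β ^ m • (y * x ^ m) := by
    induction m with
    | zero => simp
    | succ m ih =>
      rw [pow_succ, mul_assoc, hβ, mul_smul_comm, ← mul_assoc, ih, smul_mul_assoc, smul_smul,
        mul_assoc, pow_succ' β]
  have hxn : x ^ n ∈ 𝒟 0 := hng ▸ h.pow_mem h0 hx n
  obtain ⟨r, hr⟩ := h.exists_smul_eq (h.one_mem h0) one_ne_zero hxn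
  have hr0 : r ≠ 0 := by
    rintro rfl
    rw [zero_smul] at hr
    exact ((h.isUnit g x hx hx0).pow n).ne_zero hr
  have hn1 := hpow n
  rw [hr, smul_mul_assoc, one_mul, mul_smul_comm, mul_one, smul_smul] at hn1
  have hβn : β ^ n = 1 := by
    have := smul_left_injective ℝ hy0 hn1
    field_simp at this
    exact this.symm
  rcases (pow_eq_one_iff_of_ne_zero hn.ne').1 hβn with rfl | ⟨rfl, -⟩
  · left; rw [hβ, one_smul]
  · right; rw [hβ, neg_one_smul]

/-- The square of a homogeneous element commutes with all homogeneous elements, so it is a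
scalar. -/
theorem IsDivGradingDimOne.exists_sq_eq [FiniteDimensional ℝ A] [Nontrivial A]
    [Algebra.IsCentral ℝ A] (h : IsDivGradingDimOne 𝒟) {g : G} {x : A} (hx : x ∈ 𝒟 g)
    (hx0 : x ≠ 0) : ∃ r : ℝ, r ≠ 0 ∧ x * x = r • 1 := by
  have hcen : x * x ∈ Subalgebra.center ℝ A := by
    rw [Subalgebra.mem_center_iff]
    intro y
    have hy : y ∈ ⨆ g, 𝒟 g := h.iSup_eq_top ▸ Submodule.mem_top
    induction hy using Submodule.iSup_induction' with
    | mem k y hy =>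
      by_cases hy0 : y = 0
      · simp [hy0]
      rcases h.commute_or_anticommute hx hx0 hy hy0 with e | e
      · rw [mul_assoc x, e, ← mul_assoc, ← mul_assoc, e]
      · rw [mul_assoc x, e, mul_neg, ← mul_assoc x, e, neg_mul, neg_neg, mul_assoc]
    | zero => simp
    | add y z _ _ hy hz => rw [add_mul, mul_add, hy, hz]
  obtain ⟨r, hr⟩ := (Algebra.IsCentral.mem_center_iff ℝ).1 hcen
  rw [Algebra.algebraMap_eq_smul_one] at hr
  refine ⟨r, ?_, hr⟩
  rintro rfl
  rw [zero_smul] at hr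
  exact h.mul_ne_zero hx hx0 hx hx0 hr

lemma IsDivGradingDimOne.exists_normalized [FiniteDimensional ℝ A] [Nontrivial A]
    [Algebra.IsCentral ℝ A] (h : IsDivGradingDimOne 𝒟) {g : G} (hg : g ∈ support 𝒟) :
    ∃ x ∈ 𝒟 g, ∃ q : ZMod 2, x * x = sgn q • (1 : A) := by
  obtain ⟨x, hx, hx0⟩ := exists_mem_of_mem_support hg
  obtain ⟨r, hr, hxx⟩ := h.exists_sq_eq hx hx0
  refine ⟨(√|r|)⁻¹ • x, Submodule.smul_mem _ _ hx, if 0 < r then 0 else 1, ?_⟩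
  have habs : 0 < |r| := abs_pos.2 hr
  rw [smul_mul_smul_comm, hxx, smul_smul, ← mul_inv, Real.mul_self_sqrt habs.le]
  split_ifs with hpos
  · rw [abs_of_pos hpos, inv_mul_cancel₀ hr, one_smul, sgn_zero, one_smul]
  · have hneg : r < 0 := lt_of_le_of_ne (not_lt.1 hpos) hr
    rw [abs_of_neg hneg, inv_neg, neg_mul, inv_mul_cancel₀ hr, sgn_one]
    simp

/-- A division grading with one-dimensional components of a central algebra is given by a
realization of a function on its support, which is an elementary abelian 2-group. -/
theorem IsDivGradingDimOne.exists_realizes [FiniteDimensional ℝ A] [Nontrivial A]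
    [Algebra.IsCentral ℝ A] (h : IsDivGradingDimOne 𝒟) :
    ∃ (T : AddSubgroup G) (_ : Module (ZMod 2) T) (Q : T → ZMod 2) (X : Module.Basis T ℝ A),
      (T : Set G) = support 𝒟 ∧ Realizes Q X ∧ ∀ t : T, 𝒟 t = Submodule.span ℝ {X t} := by
  obtain ⟨T, hT⟩ := h.exists_addSubgroup
  have h0 : (0 : G) ∈ support 𝒟 := hT ▸ T.zero_mem
  have hmem (t : T) : (t : G) ∈ support 𝒟 := hT ▸ t.2
  choose x hx q hq using fun t : T => h.exists_normalized (hmem t)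
  have hx0 (t) : x t ≠ 0 := by
    intro h0
    have := hq t
    rw [h0, zero_mul, ← smul_zero (sgn (q t))] at this
    have h2 := congrArg (fun y => sgn (q t) • y) this
    simp only [smul_smul, sgn_mul_self, one_smul] at h2
    exact zero_ne_one h2
  have htwo (t : T) : 2 • t = 0 := by
    rw [two_nsmul]
    apply Subtype.ext
    have h1 : x t * x t ∈ 𝒟 0 := hq t ▸ zsmul_mem (h.one_mem h0) _
    exact h.degree_unique (h.mul_mem (hx t) (hx t)) h1 (h.mul_ne_zero (hx t) (hx0 t) (hx t) (hx0 t))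
  have hcomp (t : T) : 𝒟 t = Submodule.span ℝ {x t} := by
    apply le_antisymm
    · intro y hy
      obtain ⟨r, rfl⟩ := h.exists_smul_eq (hx t) (hx0 t) hy
      exact Submodule.smul_mem _ _ (Submodule.mem_span_singleton_self _)
    · rw [Submodule.span_singleton_le_iff_mem]
      exact hx t
  have hli : LinearIndependent ℝ x :=
    (h.iSupIndep.comp Subtype.val_injective).linearIndependent _ hx hx0
  have hspan : ⊤ ≤ Submodule.span ℝ (Set.range x) := by
    rw [← h.iSup_eq_top, iSup_le_iff]
    intro g
    by_cases hg : g ∈ T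
    · rw [hcomp ⟨g, hg⟩]
      exact Submodule.span_mono (Set.singleton_subset_iff.2 ⟨_, rfl⟩)
    · have : 𝒟 g = ⊥ := by
        by_contra hne
        exact hg (by rw [← SetLike.mem_coe, hT]; exact hne)
      rw [this]
      exact bot_le
  refine ⟨T, AddCommGroup.zmodModule htwo, q, Module.Basis.mk hli hspan, hT, ⟨?_, ?_⟩, ?_⟩
  · intro u v
    rw [Module.Basis.mk_apply, Module.Basis.mk_apply, Module.Basis.mk_apply]
    obtain ⟨r, hr⟩ := h.exists_smul_eq (hx (u + v)) (hx0 _) (h.mul_mem (hx u) (hx v))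
    have hsq : x u * x v * (x v * x u) = (sgn (q v + q u) : ℝ) • (1 : A) := by
      rw [mul_assoc, ← mul_assoc (x v), hq, smul_mul_assoc, one_mul, mul_smul_comm, hq,
        sgn_smul_sgn_smul, Int.cast_smul_eq_zsmul]
    have hsq' : x u * x v * (x u * x v) = (r * r * sgn (q (u + v))) • (1 : A) := by
      rw [hr, smul_mul_smul_comm, hq, ← Int.cast_smul_eq_zsmul ℝ, smul_smul]
    have hs1 (a : ZMod 2) : (sgn a : ℝ) = 1 ∨ (sgn a : ℝ) = -1 := by
      rcases zmod_two_cases a with rfl | rfl <;> simp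
    have hrr : r * r = 1 := by
      have key : r * r * sgn (q (u + v)) = sgn (q v + q u) ∨
          r * r * sgn (q (u + v)) = -sgn (q v + q u) := by
        rcases h.commute_or_anticommute (hx u) (hx0 u) (hx v) (hx0 v) with e | e
        · left
          apply smul_left_injective ℝ (one_ne_zero (α := A))
          change _ • (1 : A) = _ • (1 : A)
          rw [← hsq', ← hsq, e]
        · right
          apply smul_left_injective ℝ (one_ne_zero (α := A))
          change _ • (1 : A) = _ • (1 : A)
          rw [neg_smul, ← hsq', ← hsq]
          nth_rewrite 2 [e]
          rw [mul_neg]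
      have hnn := mul_self_nonneg r
      rcases hs1 (q (u + v)) with e1 | e1 <;> rcases hs1 (q v + q u) with e2 | e2 <;>
        rcases key with e3 | e3 <;> rw [e1, e2] at e3 <;> linarith
    rcases mul_self_eq_one_iff.1 hrr with rfl | rfl
    · exact ⟨0, by rw [hr]; simp⟩
    · exact ⟨1, by rw [hr]; simp⟩
  · intro v
    rw [Module.Basis.mk_apply, hq]
  · intro t
    rw [Module.Basis.mk_apply, hcomp]

end DivGradings

/-! ### The standard gradings -/

section Planes

variable {A : Type*} [Ring A] [Algebra ℝ A]

/-- The spanning vector `1`, `x`, `y` or `z` of `fourLines x y z`, as a function of the degree. -/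
def fourVectors (x y z : A) (g : ZMod 2 × ZMod 2) : A :=
  if g = (0, 0) then 1 else if g = (1, 0) then x else if g = (0, 1) then y else z

lemma forall_zmod_two_prod {P : ZMod 2 × ZMod 2 → Prop} (h00 : P (0, 0)) (h10 : P (1, 0))
    (h01 : P (0, 1)) (h11 : P (1, 1)) (g : ZMod 2 × ZMod 2) : P g := by
  obtain ⟨a, b⟩ := g
  rcases zmod_two_cases a with rfl | rfl <;> rcases zmod_two_cases b with rfl | rfl <;> assumption

/-- Anticommuting elements `x`, `y` with squares `±1` whose product is `±z` realize a plane, if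
`1, x, y, z` is a basis. -/
theorem exists_realizes_plane {x y z : A} {p q c : ZMod 2} (hfr : Module.finrank ℝ A = 4)
    (hli : ∀ a b d e : ℝ, a • (1 : A) + b • x + d • y + e • z = 0 → a = 0 ∧ b = 0 ∧ d = 0 ∧ e = 0)
    (hxx : x * x = sgn p • (1 : A)) (hyy : y * y = sgn q • (1 : A)) (hxy : x * y = sgn c • z)
    (hyx : y * x = sgn (c + 1) • z) :
    ∃ Y : Module.Basis (ZMod 2 × ZMod 2) ℝ A, Realizes (plane p q) Y ∧
      ∀ g, fourLines x y z g = Submodule.span ℝ {Y g} := by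
  have h2 : (2 : ZMod 2) = 0 := rfl
  have f0 : fourVectors x y z (0, 0) = 1 := rfl
  have f1 : fourVectors x y z (1, 0) = x := rfl
  have f2 : fourVectors x y z (0, 1) = y := rfl
  have f3 : fourVectors x y z (1, 1) = z := rfl
  have hind : LinearIndependent ℝ (fourVectors x y z) := by
    rw [Fintype.linearIndependent_iff]
    intro w hw
    have hu : (Finset.univ : Finset (ZMod 2 × ZMod 2)) = {(0, 0), (1, 0), (0, 1), (1, 1)} := by
      decide
    rw [hu, Finset.sum_insert (by decide), Finset.sum_insert (by decide),
      Finset.sum_insert (by decide), Finset.sum_singleton, f0, f1, f2, f3, ← add_assoc,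
      ← add_assoc] at hw
    obtain ⟨h0, h1, h2, h3⟩ := hli _ _ _ _ hw
    exact forall_zmod_two_prod h0 h1 h2 h3
  have hcancel (a : ZMod 2) (m : A) : sgn a • sgn a • m = m := by
    rw [sgn_smul_sgn_smul, CharTwo.add_self_eq_zero, sgn_zero, one_smul]
  have hz1 : z = sgn c • (x * y) := by rw [hxy, hcancel]
  have hz2 : z = sgn (c + 1) • (y * x) := by rw [hyx, hcancel]
  have hxz : x * z = sgn (c + p) • y := by
    rw [hz1, mul_smul_comm, ← mul_assoc, hxx, smul_mul_assoc, one_mul, sgn_smul_sgn_smul]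
  have hzx : z * x = sgn (c + 1 + p) • y := by
    rw [hz2, smul_mul_assoc, mul_assoc, hxx, mul_smul_comm, mul_one, sgn_smul_sgn_smul]
  have hyz : y * z = sgn (c + 1 + q) • x := by
    rw [hz2, mul_smul_comm, ← mul_assoc, hyy, smul_mul_assoc, one_mul, sgn_smul_sgn_smul]
  have hzy : z * y = sgn (c + q) • x := by
    rw [hz1, smul_mul_assoc, mul_assoc, hyy, mul_smul_comm, mul_one, sgn_smul_sgn_smul]
  have hzz : z * z = sgn (p + q + 1) • (1 : A) := by
    nth_rewrite 1 [hz1]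
    rw [smul_mul_assoc, mul_assoc, hyz, mul_smul_comm, hxx, sgn_smul_sgn_smul, sgn_smul_sgn_smul]
    congr 2
    linear_combination c * h2
  let Y := basisOfLinearIndependentOfCardEqFinrank hind (by rw [hfr]; rfl)
  have hY (g) : Y g = fourVectors x y z g := by simp [Y]
  refine ⟨Y, ⟨?_, ?_⟩, fun g => by rw [hY]; rfl⟩
  · simp only [hY]
    refine forall_zmod_two_prod ?_ ?_ ?_ ?_ <;> refine forall_zmod_two_prod ?_ ?_ ?_ ?_
    · exact ⟨0, by rw [f0]; simp [f0]⟩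
    · exact ⟨0, by rw [f0, f1]; simp [f1]⟩
    · exact ⟨0, by rw [f0, f2]; simp [f2]⟩
    · exact ⟨0, by rw [f0, f3]; simp [f3]⟩
    · exact ⟨0, by rw [f0, f1]; simp [f1]⟩
    · exact ⟨p, by rw [f1]; exact hxx⟩
    · exact ⟨c, by rw [f1, f2]; exact hxy⟩
    · exact ⟨_, by rw [f1, f3]; exact hxz⟩
    · exact ⟨0, by rw [f0, f2]; simp [f2]⟩
    · exact ⟨_, by rw [f1, f2]; exact hyx⟩
    · exact ⟨q, by rw [f2]; exact hyy⟩
    · exact ⟨_, by rw [f2, f3]; exact hyz⟩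
    · exact ⟨0, by rw [f0, f3]; simp [f3]⟩
    · exact ⟨_, by rw [f1, f3]; exact hzx⟩
    · exact ⟨_, by rw [f2, f3]; exact hzy⟩
    · exact ⟨_, by rw [f3]; exact hzz⟩
  · simp only [hY, plane_apply]
    refine forall_zmod_two_prod ?_ ?_ ?_ ?_
    · simp [f0]
    · simpa [f1] using hxx
    · simpa [f2] using hyy
    · simpa [f3] using hzz

end Planes

/-- The subspaces `𝒜 v` are spanned by the elements of a realization of a quadratic form with Arf
invariant `ε` on a space with `4ᵏ` elements. -/
def IsModel {V A : Type*} [AddCommGroup V] [Ring A] [Algebra ℝ A] (𝒜 : V → Submodule ℝ A)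
    (k : ℕ) (ε : ZMod 2) : Prop :=
  ∃ (_ : Module (ZMod 2) V) (Q : QuadraticForm (ZMod 2) V) (Y : Module.Basis V ℝ A),
    Realizes Q Y ∧ (∀ v, 𝒜 v = Submodule.span ℝ {Y v}) ∧ HasArf Q ε ∧ Nat.card V = 4 ^ k

lemma IsModel.isDivGradingDimOne {V A : Type*} [AddCommGroup V] [Ring A] [Algebra ℝ A]
    {𝒜 : V → Submodule ℝ A} {k : ℕ} {ε : ZMod 2} (h : IsModel 𝒜 k ε) : IsDivGradingDimOne 𝒜 := by
  obtain ⟨_, Q, Y, hY, hc, -, -⟩ := h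
  have : 𝒜 = basisComp (AddMonoidHom.id V) Y := by
    funext g
    exact (hc g).trans (basisComp_apply (ι := AddMonoidHom.id V) Function.injective_id Y g).symm
  rw [this]
  exact hY.isDivGradingDimOne Function.injective_id

lemma productGrading_eq_span {G H A B : Type*} [AddCommGroup G] [AddCommGroup H] [Ring A]
    [Algebra ℝ A] [Ring B] [Algebra ℝ B] {𝒜 : G → Submodule ℝ A} {ℬ : H → Submodule ℝ B}
    {X : Module.Basis G ℝ A} {Y : Module.Basis H ℝ B} (hX : ∀ g, 𝒜 g = Submodule.span ℝ {X g})
    (hY : ∀ g, ℬ g = Submodule.span ℝ {Y g}) (p : G × H) :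
    productGrading 𝒜 ℬ p = Submodule.span ℝ {X.tensorProduct Y p} := by
  rw [productGrading, TensorProduct.range_mapIncl, hX, hY, Submodule.map₂_span_span,
    Set.image2_singleton, Module.Basis.tensorProduct_apply']
  rfl

lemma IsModel.productGrading {V A B : Type*} [AddCommGroup V] [Ring A] [Algebra ℝ A] [Ring B]
    [Algebra ℝ B] {𝒜 : ZMod 2 × ZMod 2 → Submodule ℝ A} {p q : ZMod 2}
    {X : Module.Basis (ZMod 2 × ZMod 2) ℝ A} (hX : Realizes (plane p q) X)
    (h𝒜 : ∀ g, 𝒜 g = Submodule.span ℝ {X g}) {ℬ : V → Submodule ℝ B} {k : ℕ} {ε : ZMod 2}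
    (h : IsModel ℬ k ε) : IsModel (productGrading 𝒜 ℬ) (k + 1) (p * q + ε) := by
  obtain ⟨_, Q, Y, hY, hc, hε, hcard⟩ := h
  refine ⟨inferInstance, (plane p q).prod Q, X.tensorProduct Y, hX.tensorProduct hY,
    productGrading_eq_span h𝒜 hc, hε.plane_prod p q, ?_⟩
  rw [Nat.card_prod, hcard, pow_succ']
  simp

lemma hasArf_plane (p q : ZMod 2) : HasArf (plane p q) (p * q) := by
  have h := (hasArf_zero_of_subsingleton (0 : QuadraticForm (ZMod 2) Unit)).plane_prod p q
  rw [add_zero] at h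
  refine h.of_isometryEquiv ⟨LinearEquiv.prodUnique, fun v => ?_⟩
  simp

lemma isModel_real : IsModel (fun _ : Unit => (⊤ : Submodule ℝ ℝ)) 0 0 := by
  have hY (u) : Module.Basis.singleton Unit ℝ u = 1 := Module.Basis.singleton_apply Unit ℝ u
  refine ⟨inferInstance, 0, Module.Basis.singleton Unit ℝ, ⟨?_, ?_⟩, ?_, ?_, ?_⟩
  · intro u v
    exact ⟨0, by simp [hY]⟩
  · intro u
    simp [hY]
  · intro u
    rw [hY]
    exact (Ideal.span_singleton_one (α := ℝ)).symm
  · exact hasArf_zero_of_subsingleton _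
  · simp

lemma exists_realizes_matrix :
    ∃ Y : Module.Basis (ZMod 2 × ZMod 2) ℝ (Matrix (Fin 2) (Fin 2) ℝ), Realizes (plane 0 0) Y ∧
      ∀ g, fourLines !![0, 1; 1, 0] !![-1, 0; 0, 1] !![0, -1; 1, 0] g =
        Submodule.span ℝ {Y g} := by
  refine exists_realizes_plane (c := 1) ?_ ?_ ?_ ?_ ?_ ?_
  · simp [Module.finrank_matrix]
  · intro a b d e h
    have h00 := congrFun (congrFun h 0) 0
    have h01 := congrFun (congrFun h 0) 1
    have h10 := congrFun (congrFun h 1) 0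
    have h11 := congrFun (congrFun h 1) 1
    simp at h00 h01 h10 h11
    refine ⟨?_, ?_, ?_, ?_⟩ <;> linarith
  · ext i j; fin_cases i <;> fin_cases j <;> simp
  · ext i j; fin_cases i <;> fin_cases j <;> simp
  · ext i j; fin_cases i <;> fin_cases j <;> simp
  · ext i j; fin_cases i <;> fin_cases j <;> simp [CharTwo.add_self_eq_zero]

lemma isModel_quaternion :
    IsModel (fourLines (A := ℍ[ℝ]) ⟨0, 1, 0, 0⟩ ⟨0, 0, 1, 0⟩ ⟨0, 0, 0, 1⟩) 1 1 := by
  generalize hx : (⟨0, 1, 0, 0⟩ : ℍ[ℝ]) = x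
  generalize hy : (⟨0, 0, 1, 0⟩ : ℍ[ℝ]) = y
  generalize hz : (⟨0, 0, 0, 1⟩ : ℍ[ℝ]) = z
  have hx0 : x.re = 0 := by rw [← hx]
  have hx1 : x.imI = 1 := by rw [← hx]
  have hx2 : x.imJ = 0 := by rw [← hx]
  have hx3 : x.imK = 0 := by rw [← hx]
  have hy0 : y.re = 0 := by rw [← hy]
  have hy1 : y.imI = 0 := by rw [← hy]
  have hy2 : y.imJ = 1 := by rw [← hy]
  have hy3 : y.imK = 0 := by rw [← hy]
  have hz0 : z.re = 0 := by rw [← hz]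
  have hz1 : z.imI = 0 := by rw [← hz]
  have hz2 : z.imJ = 0 := by rw [← hz]
  have hz3 : z.imK = 1 := by rw [← hz]
  obtain ⟨Y, hY, hc⟩ := exists_realizes_plane (x := x) (y := y) (z := z) (p := 1) (q := 1) (c := 0)
    Quaternion.finrank_eq_four
    (by
      intro a b d e h
      have h0 := congrArg QuaternionAlgebra.re h
      have h1 := congrArg QuaternionAlgebra.imI h
      have h2 := congrArg QuaternionAlgebra.imJ h
      have h3 := congrArg QuaternionAlgebra.imK h
      simp [hx0, hx1, hx2, hx3, hy0, hy1, hy2, hy3, hz0, hz1, hz2, hz3] at h0 h1 h2 h3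
      exact ⟨h0, h1, h2, h3⟩)
    (by ext <;> simp [hx0, hx1, hx2, hx3])
    (by ext <;> simp [hy0, hy1, hy2, hy3])
    (by ext <;> simp [hx0, hx1, hx2, hx3, hy0, hy1, hy2, hy3, hz0, hz1, hz2, hz3])
    (by ext <;> simp [hx0, hx1, hx2, hx3, hy0, hy1, hy2, hy3, hz0, hz1, hz2, hz3])
  exact ⟨inferInstance, plane 1 1, Y, hY, hc, hasArf_plane 1 1, by simp⟩

lemma IsModel.tensorM2R {K : Graded} {k : ℕ} {ε : ZMod 2} (h : IsModel K.comp k ε) (m : ℕ) :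
    IsModel (tensorM2R K m).comp (m + k) ε := by
  obtain ⟨X, hX, hXc⟩ := exists_realizes_matrix
  induction m with
  | zero => rw [zero_add]; exact h
  | succ m ih =>
    have := ih.productGrading hX hXc
    rw [zero_mul, zero_add] at this
    rw [add_right_comm]
    exact this

/-! ### The algebras `Mₙ(ℝ)` and `Mₙ(ℍ)` -/

/-- Tensoring with `M₂(ℝ)` doubles the size of the matrices. -/
theorem nonempty_tensorM2R_algEquiv {𝕂 : Type*} [Ring 𝕂] [Algebra ℝ 𝕂] {K : Graded}
    (e : K.alg ≃ₐ[ℝ] 𝕂) (m : ℕ) :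
    Nonempty ((tensorM2R K m).alg ≃ₐ[ℝ] Matrix (Fin (2 ^ m)) (Fin (2 ^ m)) 𝕂) := by
  induction m with
  | zero =>
    let f : 𝕂 ≃ₐ[ℝ] Matrix (Fin 1) (Fin 1) 𝕂 :=
      AlgEquiv.ofBijective (Matrix.scalarAlgHom (Fin 1) ℝ)
        ⟨fun a b h => by simpa using congrFun (congrFun h 0) 0, fun M => ⟨M 0 0, by
          ext i j
          fin_cases i
          fin_cases j
          simp⟩⟩
    exact ⟨e.trans f⟩
  | succ m ih =>
    obtain ⟨f⟩ := ih
    let e1 : (Matrix (Fin 2) (Fin 2) ℝ ⊗[ℝ] (tensorM2R K m).alg) ≃ₐ[ℝ]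
        Matrix (Fin 2) (Fin 2) ℝ ⊗[ℝ] Matrix (Fin (2 ^ m)) (Fin (2 ^ m)) 𝕂 :=
      Algebra.TensorProduct.congr AlgEquiv.refl f
    let e2 := Matrix.kroneckerTMulAlgEquiv (Fin 2) (Fin (2 ^ m)) ℝ ℝ ℝ 𝕂
    let e3 : Matrix (Fin 2 × Fin (2 ^ m)) (Fin 2 × Fin (2 ^ m)) (ℝ ⊗[ℝ] 𝕂) ≃ₐ[ℝ]
        Matrix (Fin 2 × Fin (2 ^ m)) (Fin 2 × Fin (2 ^ m)) 𝕂 :=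
      (Algebra.TensorProduct.lid ℝ 𝕂).mapMatrix
    let e4 := Matrix.reindexAlgEquiv ℝ 𝕂
      (finProdFinEquiv.trans (finCongr (pow_succ' 2 m).symm) : Fin 2 × Fin (2 ^ m) ≃ _)
    exact ⟨((e1.trans e2).trans e3).trans e4⟩

lemma isCentral_of_algEquiv {A B : Type*} [Ring A] [Algebra ℝ A] [Ring B] [Algebra ℝ B]
    [Algebra.IsCentral ℝ A] (e : A ≃ₐ[ℝ] B) : Algebra.IsCentral ℝ B where
  out x hx := by
    rw [Subalgebra.mem_center_iff] at hx
    have h : e.symm x ∈ Subalgebra.center ℝ A := by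
      rw [Subalgebra.mem_center_iff]
      intro y
      apply e.injective
      rw [map_mul, map_mul, e.apply_symm_apply, hx]
    obtain ⟨r, hr⟩ := (Algebra.IsCentral.mem_center_iff ℝ).1 h
    exact Algebra.mem_bot.2 ⟨r, by rw [← e.commutes, ← hr, e.apply_symm_apply]⟩

instance isCentral_quaternion : Algebra.IsCentral ℝ ℍ[ℝ] where
  out x hx := by
    rw [Subalgebra.mem_center_iff] at hx
    obtain ⟨i, i0, i1, i2, i3⟩ : ∃ i : ℍ[ℝ], i.re = 0 ∧ i.imI = 1 ∧ i.imJ = 0 ∧ i.imK = 0 :=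
      ⟨⟨0, 1, 0, 0⟩, rfl, rfl, rfl, rfl⟩
    obtain ⟨j, j0, j1, j2, j3⟩ : ∃ j : ℍ[ℝ], j.re = 0 ∧ j.imI = 0 ∧ j.imJ = 1 ∧ j.imK = 0 :=
      ⟨⟨0, 0, 1, 0⟩, rfl, rfl, rfl, rfl⟩
    have h1 := congrArg QuaternionAlgebra.imK (hx i)
    have h2 := congrArg QuaternionAlgebra.imJ (hx i)
    have h3 := congrArg QuaternionAlgebra.imK (hx j)
    simp [i0, i1, i2, i3] at h1 h2
    simp [j0, j1, j2, j3] at h3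
    refine Algebra.mem_bot.2 ⟨x.re, ?_⟩
    ext
    · simp
    · simp; linarith
    · simp; linarith
    · simp; linarith

/-- `Mₙ(ℝ)` contains an element `e ≠ 0` such that `e d e` is always a scalar multiple of `e`, but
`Mₖ(ℍ)` does not. -/
theorem isEmpty_algEquiv_matrix {n k : ℕ} (hn : 0 < n) :
    IsEmpty (Matrix (Fin n) (Fin n) ℝ ≃ₐ[ℝ] Matrix (Fin k) (Fin k) ℍ[ℝ]) := by
  refine ⟨fun φ => ?_⟩
  let e : Matrix (Fin n) (Fin n) ℝ := Matrix.single ⟨0, hn⟩ ⟨0, hn⟩ 1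
  have he (d) : ∃ r : ℝ, e * d * e = r • e :=
    ⟨d ⟨0, hn⟩ ⟨0, hn⟩, by simp [e, Matrix.single_mul_mul_single, Matrix.smul_single]⟩
  have he0 : e ≠ 0 := fun h => by
    have := congrFun (congrFun h ⟨0, hn⟩) ⟨0, hn⟩
    simp [e] at this
  have hf (d) : ∃ r : ℝ, φ e * d * φ e = r • φ e := by
    obtain ⟨r, hr⟩ := he (φ.symm d)
    exact ⟨r, by rw [← map_smul, ← hr, map_mul, map_mul, φ.apply_symm_apply]⟩
  have hf0 : φ e ≠ 0 := by simpa using he0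
  obtain ⟨i, j, hij⟩ : ∃ i j, φ e i j ≠ 0 := by
    by_contra! h
    exact hf0 (Matrix.ext h)
  -- The entries `(i, j)` of `f d f`, for `d` supported at `(j, i)`, fill `ℍ`.
  obtain ⟨ω, hω⟩ : ∃ ω : ℍ[ℝ], ω.imI = 1 := ⟨⟨0, 1, 0, 0⟩, rfl⟩
  obtain ⟨r, hr⟩ := hf (Matrix.single j i ((φ e i j)⁻¹ * ω))
  have h := congrFun (congrFun hr i) j
  rw [Matrix.mul_assoc, Matrix.mul_apply, Finset.sum_eq_single j
    (fun b _ hb => by rw [Matrix.single_mul_apply_of_ne (h := hb), mul_zero]) (by simp),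
    Matrix.single_mul_apply_same, mul_assoc (φ e i j)⁻¹, mul_inv_cancel_left₀ hij,
    Matrix.smul_apply, ← Quaternion.coe_mul_eq_smul] at h
  have := congrArg QuaternionAlgebra.imI (mul_right_cancel₀ (M₀ := ℍ[ℝ]) hij h)
  simp [hω] at this

/-! ### Pairs attached to gradings -/

section Classification

lemma nonempty_addEquiv_of_card {V : Type*} [AddCommGroup V] [Module (ZMod 2) V] {k : ℕ}
    (h : Nat.card V = 4 ^ k) : Nonempty (V ≃+ (Fin (2 * k) → ZMod 2)) := by
  have : Finite V := Nat.finite_of_card_ne_zero (by rw [h]; positivity)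
  have hr : Module.finrank (ZMod 2) V = 2 * k := by
    rw [Module.natCard_eq_pow_finrank (K := ZMod 2), Nat.card_zmod,
      show 4 = 2 ^ 2 by norm_num, ← pow_mul] at h
    exact Nat.pow_right_injective le_rfl h
  exact ⟨(LinearEquiv.ofFinrankEq V (Fin (2 * k) → ZMod 2) (by rw [hr]; simp)).toAddEquiv⟩

variable {G : Type*} [AddCommGroup G] {D : Type*} [Ring D] [Algebra ℝ D]

/-- The content of `IsDivGradingDimOne.exists_realizes`, with a quadratic form. -/
theorem IsDivGradingDimOne.exists_form [FiniteDimensional ℝ D] [Nontrivial D]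
    [Algebra.IsCentral ℝ D] {𝒟 : G → Submodule ℝ D} (h : IsDivGradingDimOne 𝒟) :
    ∃ (T : AddSubgroup G) (_ : Module (ZMod 2) T) (Q : QuadraticForm (ZMod 2) T)
      (X : Module.Basis T ℝ D), (T : Set G) = support 𝒟 ∧ Realizes Q X ∧
        (∀ t : T, 𝒟 t = Submodule.span ℝ {X t}) ∧ IsTypeI Q := by
  obtain ⟨T, _, q, X, hT, hX, hspan⟩ := h.exists_realizes
  obtain ⟨Q, hQ⟩ := hX.exists_quadraticForm
  obtain rfl : ⇑Q = q := funext hQ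
  exact ⟨T, _, Q, X, hT, hX, hspan, hX.isTypeI⟩

/-- The support carries a form of type I, so its dimension over `𝔽₂` is even. Its order is the
dimension of `D`. -/
theorem IsDivGradingDimOne.exists_card_support [FiniteDimensional ℝ D] [Nontrivial D]
    [Algebra.IsCentral ℝ D] {𝒟 : G → Submodule ℝ D} (h : IsDivGradingDimOne 𝒟) :
    ∃ k : ℕ, Module.finrank ℝ D = 4 ^ k ∧ ∃ T : AddSubgroup G, (T : Set G) = support 𝒟 ∧
      Nonempty (T ≃+ (Fin (2 * k) → ZMod 2)) := by
  obtain ⟨T, _, Q, X, hT, hX, -, hQ⟩ := h.exists_form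
  have : Finite T := Module.Finite.finite_basis X
  cases nonempty_fintype T
  obtain ⟨ε, hε⟩ := hQ.exists_hasArf
  obtain ⟨k, hk, -⟩ := hε.card_and_gauss
  exact ⟨k, (Module.finrank_eq_nat_card_basis X).trans hk, T, hT, nonempty_addEquiv_of_card hk⟩

lemma sgn_smul_one {R : Type*} [Ring R] (a : ZMod 2) : sgn a • (1 : R) = (-1) ^ a.val := by
  simp [sgn]

/-- Nonzero multiples of `X v` have squares of the same sign. -/
lemma Realizes.eq_of_sq {V : Type*} [AddCommGroup V] {Q : V → ZMod 2}
    {X : Module.Basis V ℝ D} (hX : Realizes Q X) {v : V} {x : D} (hx : x ∈ Submodule.span ℝ {X v})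
    {a : ZMod 2} (ha : x * x = (-1) ^ a.val) : a = Q v := by
  obtain ⟨r, rfl⟩ := Submodule.mem_span_singleton.1 hx
  have h1 : (1 : D) ≠ 0 := fun h10 => X.ne_zero v (by rw [← mul_one (X v), h10, mul_zero])
  rw [← sgn_smul_one, smul_mul_smul_comm, hX.sq, ← Int.cast_smul_eq_zsmul ℝ,
    ← Int.cast_smul_eq_zsmul ℝ (sgn a), smul_smul] at ha
  have key := smul_left_injective ℝ h1 ha
  have hr := mul_self_nonneg r
  rcases zmod_two_cases a with rfl | rfl <;> rcases zmod_two_cases (Q v) with h | h <;>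
    rw [h] at key ⊢ <;> simp at key <;> nlinarith

lemma map_span_eq_of_sgn {B : Type*} [Ring B] [Algebra ℝ B] (φ : D ≃ₐ[ℝ] B) {x : D} {y : B}
    (h : ∃ s, φ x = sgn s • y) :
    (Submodule.span ℝ {x}).map φ.toLinearMap = Submodule.span ℝ {y} := by
  obtain ⟨s, hs⟩ := h
  rw [Submodule.map_span, Set.image_singleton]
  change Submodule.span ℝ {φ x} = _
  rw [hs]
  rcases zmod_two_cases s with rfl | rfl
  · simp
  · rw [sgn_one, neg_one_zsmul, ← Set.neg_singleton, Submodule.span_neg]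

/-- A form with the same invariants as the model is realized in the algebra of the model. -/
theorem IsModel.exists_realizes {V W B : Type*} [AddCommGroup V] [Module (ZMod 2) V]
    [AddCommGroup W] [Ring B] [Algebra ℝ B] [Algebra.IsCentral ℝ B] {ℬ : W → Submodule ℝ B}
    {k : ℕ} {ε : ZMod 2} (hB : IsModel ℬ k ε) {Q : QuadraticForm (ZMod 2) V} (hQ : IsTypeI Q)
    (hε : HasArf Q ε) (hk : Nat.card V = 4 ^ k) :
    ∃ (σ : V ≃+ W) (Z : Module.Basis V ℝ B), Realizes Q Z ∧
      ∀ v, ℬ (σ v) = Submodule.span ℝ {Z v} := by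
  obtain ⟨_, R, Y, hY, hspan, hR, hW⟩ := hB
  have : Finite V := Nat.finite_of_card_ne_zero (by rw [hk]; positivity)
  have : Finite W := Nat.finite_of_card_ne_zero (by rw [hW]; positivity)
  obtain ⟨e⟩ := hQ.isometryEquiv_of_hasArf hY.isTypeI (hk.trans hW.symm) hε hR
  let σ : V ≃+ W := e.toLinearEquiv.toAddEquiv
  have h := hY.reindex σ.symm
  have hQR : (fun v => R (σ.symm.symm v)) = Q := funext fun v => e.map_app v
  rw [hQR] at h
  refine ⟨σ, Y.reindex σ.symm.toEquiv, h, fun v => ?_⟩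
  rw [hspan, Module.Basis.reindex_apply]
  rfl

/-- A grading with an attached pair `(T, μ)` is given by a realization of `μ`. -/
theorem QuadPair.IsAttachedTo.exists_realizes [FiniteDimensional ℝ D] [Nontrivial D]
    [Algebra.IsCentral ℝ D] {𝒟 : G → Submodule ℝ D} (h : IsDivGradingDimOne 𝒟) {r : ℕ}
    {ε : ZMod 2} {p : QuadPair G r ε} (hp : p.IsAttachedTo 𝒟) :
    ∃ X : Module.Basis p.T ℝ D, Realizes p.μ X ∧ ∀ t : p.T, 𝒟 t = Submodule.span ℝ {X t} := by
  obtain ⟨T, _, Q, X, hT, hX, hspan, -⟩ := h.exists_form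
  obtain ⟨T', μ, iso, hq⟩ := p
  obtain ⟨hT', hμ⟩ := hp
  obtain rfl : T = T' := SetLike.coe_injective (hT.trans hT'.symm)
  have : ⇑Q = μ := funext fun t => by
    obtain ⟨x, hx, hxx⟩ := hμ t
    rw [hspan] at hx
    exact (hX.eq_of_sq hx hxx).symm
  exact ⟨X, this ▸ hX, hspan⟩

lemma QuadPair.IsAttachedTo.unique [FiniteDimensional ℝ D] [Nontrivial D]
    [Algebra.IsCentral ℝ D] {𝒟 : G → Submodule ℝ D} (h : IsDivGradingDimOne 𝒟) {r : ℕ}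
    {ε : ZMod 2} {p p' : QuadPair G r ε} (hp : p.IsAttachedTo 𝒟) (hp' : p'.IsAttachedTo 𝒟) :
    p = p' := by
  obtain ⟨X, hX, hspan⟩ := hp.exists_realizes h
  obtain ⟨T, μ, iso, hq⟩ := p
  obtain ⟨T', μ', iso', hq'⟩ := p'
  obtain rfl : T = T' := SetLike.coe_injective (hp.1.trans hp'.1.symm)
  obtain rfl : μ = μ' := funext fun t => by
    obtain ⟨x, hx, hxx⟩ := hp'.2 t
    have hx' : x ∈ Submodule.span ℝ {X t} := hspan t ▸ hx
    exact (hX.eq_of_sq hx' hxx).symm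
  rfl

lemma QuadPair.IsAttachedTo.of_isomorphic {𝒟 𝒟' : G → Submodule ℝ D} {r : ℕ} {ε : ZMod 2}
    {p : QuadPair G r ε} (hp : p.IsAttachedTo 𝒟) (h : Isomorphic 𝒟 𝒟') : p.IsAttachedTo 𝒟' := by
  obtain ⟨φ, hφ⟩ := h
  refine ⟨hp.1.trans ?_, fun t => ?_⟩
  · ext g
    change 𝒟 g ≠ ⊥ ↔ 𝒟' g ≠ ⊥
    rw [← hφ g, Ne, Ne, Submodule.map_eq_bot_iff (p := 𝒟 g) (e := φ.toLinearEquiv)]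
  · obtain ⟨x, hx, hxx⟩ := hp.2 t
    refine ⟨φ x, hφ t ▸ Submodule.mem_map_of_mem hx, ?_⟩
    rw [← map_mul, hxx, map_pow, map_neg, map_one]

lemma QuadPair.IsAttachedTo.isomorphic [FiniteDimensional ℝ D] [Nontrivial D]
    [Algebra.IsCentral ℝ D] {𝒟 𝒟' : G → Submodule ℝ D} (h : IsDivGradingDimOne 𝒟)
    (h' : IsDivGradingDimOne 𝒟') {r : ℕ} {ε : ZMod 2} {p : QuadPair G r ε}
    (hp : p.IsAttachedTo 𝒟) (hp' : p.IsAttachedTo 𝒟') : Isomorphic 𝒟 𝒟' := by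
  obtain ⟨X, hX, hspan⟩ := hp.exists_realizes h
  obtain ⟨X', hX', hspan'⟩ := hp'.exists_realizes h'
  obtain ⟨_, -⟩ := p.isQuad
  obtain ⟨φ, hφ⟩ := hX.exists_algEquiv hX'
  refine ⟨φ, fun g => ?_⟩
  by_cases hg : g ∈ p.T
  · have e1 := hspan ⟨g, hg⟩
    have e2 := hspan' ⟨g, hg⟩
    simp only at e1 e2
    rw [e1, e2]
    exact map_span_eq_of_sgn φ (hφ _)
  · have e1 : 𝒟 g = ⊥ := by
      by_contra hne
      exact hg (by rw [← SetLike.mem_coe, hp.1]; exact hne)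
    have e2 : 𝒟' g = ⊥ := by
      by_contra hne
      exact hg (by rw [← SetLike.mem_coe, hp'.1]; exact hne)
    rw [e1, e2, Submodule.map_bot]

/-! ### Classification -/

/-- The correspondence between gradings and pairs, and the equivalence of all gradings, for a
central algebra `D` isomorphic to the algebra of a model, as soon as all forms realized in `D` have
the Arf invariant of the model. -/
theorem classification_of_isModel [FiniteDimensional ℝ D] [Nontrivial D]
    [Algebra.IsCentral ℝ D] {W B : Type*} [AddCommGroup W] [Ring B] [Algebra ℝ B]
    {ℬ : W → Submodule ℝ B} {k : ℕ} {ε : ZMod 2} (hB : IsModel ℬ k ε) (e : D ≃ₐ[ℝ] B)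
    (hArf : ∀ (T : AddSubgroup G) (_ : Module (ZMod 2) T) (Q : QuadraticForm (ZMod 2) T)
      (X : Module.Basis T ℝ D), Realizes Q X → HasArf Q ε) :
    (∃ F : IsoClasses G D ≃ QuadPair G (2 * k) ε,
      ∀ 𝒟 : DivGradingDimOne G D, (F (Quotient.mk _ 𝒟)).IsAttachedTo 𝒟.1) ∧
    ∀ 𝒟 : DivGradingDimOne G D, Equivalent 𝒟.1 ℬ := by
  have : Algebra.IsCentral ℝ B := isCentral_of_algEquiv e
  have hcard {T : AddSubgroup G} (X : Module.Basis T ℝ D) : Nat.card T = 4 ^ k := by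
    obtain ⟨_, _, Y, -, -, -, hW⟩ := hB
    rw [← Module.finrank_eq_nat_card_basis X, e.toLinearEquiv.finrank_eq,
      Module.finrank_eq_nat_card_basis Y, hW]
  have hex (𝒟 : DivGradingDimOne G D) : ∃ p : QuadPair G (2 * k) ε, p.IsAttachedTo 𝒟.1 := by
    obtain ⟨T, _, Q, X, hT, hX, hspan, hQ⟩ := 𝒟.2.exists_form
    refine ⟨⟨T, Q, nonempty_addEquiv_of_card (hcard X),
      ⟨_, Q, fun _ => rfl, hQ, hArf T _ Q X hX⟩⟩, hT, fun t => ⟨X t, ?_, ?_⟩⟩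
    · rw [hspan]
      exact Submodule.mem_span_singleton_self _
    · rw [hX.sq, sgn_smul_one]
  constructor
  · choose pair hpair using hex
    let f : IsoClasses G D → QuadPair G (2 * k) ε := Quotient.lift pair fun 𝒟 𝒟' h =>
      QuadPair.IsAttachedTo.unique 𝒟'.2 ((hpair 𝒟).of_isomorphic h) (hpair 𝒟')
    have hf : Function.Bijective f := by
      constructor
      · rintro ⟨𝒟⟩ ⟨𝒟'⟩ h
        have h' : pair 𝒟 = pair 𝒟' := h
        exact Quotient.sound ((hpair 𝒟).isomorphic 𝒟.2 𝒟'.2 (h' ▸ hpair 𝒟'))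
      · intro p
        obtain ⟨_, Q, hQμ, hQ, hε⟩ := p.isQuad
        have hT : Nat.card p.T = 4 ^ k := by
          obtain ⟨i⟩ := p.iso
          rw [Nat.card_congr i.toEquiv, Nat.card_fun]
          simp [pow_mul]
        obtain ⟨-, Z, hZ, -⟩ := hB.exists_realizes hQ hε hT
        let X := Z.map e.symm.toLinearEquiv
        have hX : Realizes Q X := hZ.map e.symm
        have hι : Function.Injective p.T.subtype := p.T.subtype_injective
        refine ⟨Quotient.mk _ ⟨basisComp p.T.subtype X, hX.isDivGradingDimOne hι⟩, ?_⟩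
        refine QuadPair.IsAttachedTo.unique (hX.isDivGradingDimOne hι) (hpair _) ⟨?_, fun t => ?_⟩
        · rw [support_basisComp hι]
          simp
        · refine ⟨X t, ?_, ?_⟩
          · have := basisComp_apply hι X t
            rw [AddSubgroup.subtype_apply] at this
            rw [this]
            exact Submodule.mem_span_singleton_self _
          · rw [hX.sq, sgn_smul_one, hQμ]
    exact ⟨Equiv.ofBijective f hf, hpair⟩
  · intro 𝒟
    obtain ⟨T, _, Q, X, hT, hX, hspan, hQ⟩ := 𝒟.2.exists_form
    obtain ⟨σ, Z, hZ, hℬ⟩ := hB.exists_realizes hQ (hArf T _ Q X hX) (hcard X)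
    obtain ⟨φ, hφ⟩ := hX.exists_algEquiv hZ
    have hsupp (w : W) : w ∈ support ℬ := by
      obtain ⟨v, rfl⟩ := σ.surjective w
      change ℬ (σ v) ≠ ⊥
      rw [hℬ, Ne, Submodule.span_singleton_eq_bot]
      exact Z.ne_zero v
    refine ⟨φ, (Equiv.setCongr hT).symm.trans
      (σ.toEquiv.trans (Equiv.subtypeUnivEquiv hsupp).symm), ?_⟩
    rintro ⟨t, ht⟩
    have htT : t ∈ T := by rw [← SetLike.mem_coe, hT]; exact ht
    change (𝒟.1 ((⟨t, htT⟩ : T) : G)).map φ.toLinearMap = ℬ (σ ⟨t, htT⟩)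
    rw [hspan, hℬ]
    exact map_span_eq_of_sgn φ (hφ _)

/-- The algebra in which a form is realized is determined by the size of the space and the Arf
invariant. -/
lemma Realizes.nonempty_algEquiv_of_isModel {V W B : Type*} [AddCommGroup V] [Module (ZMod 2) V]
    [AddCommGroup W] [Ring B] [Algebra ℝ B] [Algebra.IsCentral ℝ D] [Algebra.IsCentral ℝ B]
    {ℬ : W → Submodule ℝ B} {k : ℕ} {ε : ZMod 2} (hB : IsModel ℬ k ε)
    {Q : QuadraticForm (ZMod 2) V} {X : Module.Basis V ℝ D} (hX : Realizes Q X)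
    (hε : HasArf Q ε) (hk : Nat.card V = 4 ^ k) : Nonempty (D ≃ₐ[ℝ] B) := by
  obtain ⟨-, Z, hZ, -⟩ := hB.exists_realizes hX.isTypeI hε hk
  obtain ⟨φ, -⟩ := hX.exists_algEquiv hZ
  exact ⟨φ⟩

lemma isModel_tensor_gradedR (m : ℕ) : IsModel (tensorM2R gradedR m).comp m 0 :=
  IsModel.tensorM2R (K := gradedR) isModel_real m

lemma isModel_tensor_gradedH (m : ℕ) : IsModel (tensorM2R gradedH m).comp (m + 1) 1 :=
  IsModel.tensorM2R (K := gradedH) isModel_quaternion m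

lemma nonempty_tensor_gradedR_algEquiv (m : ℕ) : Nonempty ((tensorM2R gradedR m).alg ≃ₐ[ℝ]
    Matrix (Fin (2 ^ m)) (Fin (2 ^ m)) ℝ) :=
  nonempty_tensorM2R_algEquiv (K := gradedR) (AlgEquiv.refl (A₁ := ℝ)) m

lemma nonempty_tensor_gradedH_algEquiv (m : ℕ) : Nonempty ((tensorM2R gradedH m).alg ≃ₐ[ℝ]
    Matrix (Fin (2 ^ m)) (Fin (2 ^ m)) ℍ[ℝ]) :=
  nonempty_tensorM2R_algEquiv (K := gradedH) (AlgEquiv.refl (A₁ := ℍ[ℝ])) m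

instance isCentral_tensor_gradedR (m : ℕ) : Algebra.IsCentral ℝ (tensorM2R gradedR m).alg := by
  obtain ⟨e⟩ := nonempty_tensor_gradedR_algEquiv m
  exact isCentral_of_algEquiv e.symm

instance isCentral_tensor_gradedH (m : ℕ) : Algebra.IsCentral ℝ (tensorM2R gradedH m).alg := by
  obtain ⟨e⟩ := nonempty_tensor_gradedH_algEquiv m
  exact isCentral_of_algEquiv e.symm

/-- With Arf invariant `1` the algebra would be a matrix algebra over `ℍ`. -/
theorem Realizes.hasArf_zero {V : Type*} [AddCommGroup V] [Module (ZMod 2) V] {m : ℕ}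
    (e : D ≃ₐ[ℝ] Matrix (Fin (2 ^ m)) (Fin (2 ^ m)) ℝ) {Q : QuadraticForm (ZMod 2) V}
    {X : Module.Basis V ℝ D} (hX : Realizes Q X) : HasArf Q 0 := by
  have : Algebra.IsCentral ℝ D := isCentral_of_algEquiv e.symm
  have : FiniteDimensional ℝ D := e.symm.toLinearEquiv.finiteDimensional
  have hk : Nat.card V = 4 ^ m := by
    rw [← Module.finrank_eq_nat_card_basis X, e.toLinearEquiv.finrank_eq, Module.finrank_matrix]
    simp [← mul_pow]
  have : Finite V := Nat.finite_of_card_ne_zero (by rw [hk]; positivity)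
  cases nonempty_fintype V
  obtain ⟨ε, hε⟩ := hX.isTypeI.exists_hasArf
  rcases zmod_two_cases ε with rfl | rfl
  · exact hε
  · exfalso
    obtain ⟨k, hk', -, h0⟩ := hε.card_and_gauss
    obtain rfl : m = k := Nat.pow_right_injective (by norm_num : 2 ≤ 4) (hk.symm.trans hk')
    cases m with
    | zero =>
      -- The form on the zero space has Arf invariant `0`.
      exact one_ne_zero (h0 rfl)
    | succ m =>
      obtain ⟨φ⟩ := hX.nonempty_algEquiv_of_isModel (isModel_tensor_gradedH m) hε hk
      obtain ⟨ψ⟩ := nonempty_tensor_gradedH_algEquiv m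
      exact (isEmpty_algEquiv_matrix (by positivity)).false ((e.symm.trans φ).trans ψ)

/-- With Arf invariant `0` the algebra would be a matrix algebra over `ℝ`. -/
theorem Realizes.hasArf_one {V : Type*} [AddCommGroup V] [Module (ZMod 2) V] {m : ℕ}
    (e : D ≃ₐ[ℝ] Matrix (Fin (2 ^ m)) (Fin (2 ^ m)) ℍ[ℝ]) {Q : QuadraticForm (ZMod 2) V}
    {X : Module.Basis V ℝ D} (hX : Realizes Q X) : HasArf Q 1 := by
  have : Algebra.IsCentral ℝ D := isCentral_of_algEquiv e.symm
  have : FiniteDimensional ℝ D := e.symm.toLinearEquiv.finiteDimensional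
  have hk : Nat.card V = 4 ^ (m + 1) := by
    rw [← Module.finrank_eq_nat_card_basis X, e.toLinearEquiv.finrank_eq, Module.finrank_matrix,
      Quaternion.finrank_eq_four]
    simp [← mul_pow, pow_succ]
  have : Finite V := Nat.finite_of_card_ne_zero (by rw [hk]; positivity)
  obtain ⟨ε, hε⟩ := hX.isTypeI.exists_hasArf
  rcases zmod_two_cases ε with rfl | rfl
  · exfalso
    obtain ⟨φ⟩ := hX.nonempty_algEquiv_of_isModel (isModel_tensor_gradedR (m + 1)) hε hk
    obtain ⟨ψ⟩ := nonempty_tensor_gradedR_algEquiv (m + 1)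
    exact (isEmpty_algEquiv_matrix (by positivity)).false ((ψ.symm.trans φ.symm).trans e)
  · exact hε

end Classification

end RealDivGrading

theorem mainTheorem1 {G : Type*} [AddCommGroup G] {D : Type*} [Ring D] [Algebra ℝ D] :
    -- the algebras `Mₙ(ℝ)`: `n`, the support, the isomorphism classes, the equivalence class
    (∀ n : ℕ, 0 < n → Nonempty (D ≃ₐ[ℝ] Matrix (Fin n) (Fin n) ℝ) →
      ∀ 𝒟 : G → Submodule ℝ D, RealDivGrading.IsDivGradingDimOne 𝒟 →
        ∃ m : ℕ, n = 2 ^ m ∧ ∃ T : AddSubgroup G, (T : Set G) = RealDivGrading.support 𝒟 ∧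
          Nonempty (T ≃+ (Fin (2 * m) → ZMod 2))) ∧
    (∀ m : ℕ, Nonempty (D ≃ₐ[ℝ] Matrix (Fin (2 ^ m)) (Fin (2 ^ m)) ℝ) →
      (∃ F : RealDivGrading.IsoClasses G D ≃ RealDivGrading.QuadPair G (2 * m) 0,
        ∀ 𝒟 : RealDivGrading.DivGradingDimOne G D,
          (F (Quotient.mk _ 𝒟)).IsAttachedTo 𝒟.1) ∧
      ∀ 𝒟 : RealDivGrading.DivGradingDimOne G D,
        RealDivGrading.Equivalent 𝒟.1
          (RealDivGrading.tensorM2R RealDivGrading.gradedR m).comp) ∧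
    (∀ m : ℕ,
      RealDivGrading.IsDivGradingDimOne
        (RealDivGrading.tensorM2R RealDivGrading.gradedR m).comp ∧
      Nonempty ((RealDivGrading.tensorM2R RealDivGrading.gradedR m).alg ≃ₐ[ℝ]
        Matrix (Fin (2 ^ m)) (Fin (2 ^ m)) ℝ)) ∧
    -- the algebras `Mₙ(ℍ)`: `n`, the support, the isomorphism classes, the equivalence class
    (∀ n : ℕ, 0 < n → Nonempty (D ≃ₐ[ℝ] Matrix (Fin n) (Fin n) ℍ[ℝ]) →
      ∀ 𝒟 : G → Submodule ℝ D, RealDivGrading.IsDivGradingDimOne 𝒟 →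
        ∃ m : ℕ, n = 2 ^ m ∧ ∃ T : AddSubgroup G, (T : Set G) = RealDivGrading.support 𝒟 ∧
          Nonempty (T ≃+ (Fin (2 * m + 2) → ZMod 2))) ∧
    (∀ m : ℕ, Nonempty (D ≃ₐ[ℝ] Matrix (Fin (2 ^ m)) (Fin (2 ^ m)) ℍ[ℝ]) →
      (∃ F : RealDivGrading.IsoClasses G D ≃ RealDivGrading.QuadPair G (2 * m + 2) 1,
        ∀ 𝒟 : RealDivGrading.DivGradingDimOne G D,
          (F (Quotient.mk _ 𝒟)).IsAttachedTo 𝒟.1) ∧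
      ∀ 𝒟 : RealDivGrading.DivGradingDimOne G D,
        RealDivGrading.Equivalent 𝒟.1
          (RealDivGrading.tensorM2R RealDivGrading.gradedH m).comp) ∧
    (∀ m : ℕ,
      RealDivGrading.IsDivGradingDimOne
        (RealDivGrading.tensorM2R RealDivGrading.gradedH m).comp ∧
      Nonempty ((RealDivGrading.tensorM2R RealDivGrading.gradedH m).alg ≃ₐ[ℝ]
        Matrix (Fin (2 ^ m)) (Fin (2 ^ m)) ℍ[ℝ])) ∧
    -- the Arf invariant is well defined
    (∀ (V : Type*) [AddCommGroup V] [Module (ZMod 2) V] [Finite V]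
      (Q : QuadraticForm (ZMod 2) V), RealDivGrading.IsTypeI Q →
        ∃! ε : ZMod 2, RealDivGrading.HasArf Q ε) := by
  refine ⟨?_, ?_, fun m => ⟨?_, ?_⟩, ?_, ?_, fun m => ⟨?_, ?_⟩, ?_⟩
  · rintro n hn ⟨e⟩ 𝒟 h𝒟
    have : NeZero n := ⟨hn.ne'⟩
    have : Algebra.IsCentral ℝ D := RealDivGrading.isCentral_of_algEquiv e.symm
    have : FiniteDimensional ℝ D := e.symm.toLinearEquiv.finiteDimensional
    have : Nontrivial D := e.toEquiv.nontrivial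
    obtain ⟨k, hk, T, hT, hiso⟩ := h𝒟.exists_card_support
    refine ⟨k, ?_, T, hT, hiso⟩
    rw [e.toLinearEquiv.finrank_eq, Module.finrank_matrix] at hk
    simp only [Fintype.card_fin, Module.finrank_self, mul_one] at hk
    refine Nat.pow_left_injective two_ne_zero ?_
    change n ^ 2 = (2 ^ k) ^ 2
    rw [sq, hk, ← pow_mul, mul_comm, pow_mul]
    norm_num
  · rintro m ⟨e⟩
    have : Algebra.IsCentral ℝ D := RealDivGrading.isCentral_of_algEquiv e.symm
    have : FiniteDimensional ℝ D := e.symm.toLinearEquiv.finiteDimensional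
    have : Nontrivial D := e.toEquiv.nontrivial
    obtain ⟨ψ⟩ := RealDivGrading.nonempty_tensor_gradedR_algEquiv m
    exact RealDivGrading.classification_of_isModel (RealDivGrading.isModel_tensor_gradedR m)
      (e.trans ψ.symm) fun T _ Q X hX => hX.hasArf_zero e
  · exact (RealDivGrading.isModel_tensor_gradedR m).isDivGradingDimOne
  · exact RealDivGrading.nonempty_tensor_gradedR_algEquiv m
  · rintro n hn ⟨e⟩ 𝒟 h𝒟
    have : NeZero n := ⟨hn.ne'⟩
    have : Algebra.IsCentral ℝ D := RealDivGrading.isCentral_of_algEquiv e.symm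
    have : FiniteDimensional ℝ D := e.symm.toLinearEquiv.finiteDimensional
    have : Nontrivial D := e.toEquiv.nontrivial
    obtain ⟨k, hk, T, hT, hiso⟩ := h𝒟.exists_card_support
    rw [e.toLinearEquiv.finrank_eq, Module.finrank_matrix, Quaternion.finrank_eq_four] at hk
    simp only [Fintype.card_fin] at hk
    cases k with
    | zero => omega
    | succ m =>
      refine ⟨m, ?_, T, hT, hiso⟩
      refine Nat.pow_left_injective two_ne_zero ?_
      change n ^ 2 = (2 ^ m) ^ 2
      rw [pow_succ] at hk
      rw [sq, Nat.eq_of_mul_eq_mul_right (by norm_num) hk, ← pow_mul, mul_comm, pow_mul]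
      norm_num
  · rintro m ⟨e⟩
    have : Algebra.IsCentral ℝ D := RealDivGrading.isCentral_of_algEquiv e.symm
    have : FiniteDimensional ℝ D := e.symm.toLinearEquiv.finiteDimensional
    have : Nontrivial D := e.toEquiv.nontrivial
    obtain ⟨ψ⟩ := RealDivGrading.nonempty_tensor_gradedH_algEquiv m
    exact RealDivGrading.classification_of_isModel (RealDivGrading.isModel_tensor_gradedH m)
      (e.trans ψ.symm) fun T _ Q X hX => hX.hasArf_one e
  · exact (RealDivGrading.isModel_tensor_gradedH m).isDivGradingDimOne
  · exact RealDivGrading.nonempty_tensor_gradedH_algEquiv m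
  · intro V _ _ _ Q hQ
    obtain ⟨ε, hε⟩ := hQ.exists_hasArf
    exact ⟨ε, hε, fun ε' hε' => hε'.unique hε⟩
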